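/- Let $k$ be a field, let $1\le n\le m$, let $R=k[x_{ij}\mid 1\le i\le n,\ 1\le j\le m]$ with the standard grading, and let $M=(x_{ij})$ be the generic $n\times m$ matrix. Let $<$ be the lexicographic monomial order on $R$ with $x_{11}>x_{12}>\cdots>x_{1m}>x_{21}>\cdots>x_{nm}$. Let $\Delta$ be an $(n-1)$-pure simplicial complex on vertices in $[m]=\{1,\dots,m\}$, i.e. every facet of $\Delta$ has exactly $n$ elements. Let $J_\Delta\subseteq R$ be its $n$-determinantal facet ideal, generated by the maximal minors of $M$ on the column sets $\sigma$, for $\sigma$ a facet of $\Delta$, and let $\operatorname{in}_<(J_\Delta)$ be the ideal generated by the leading terms of the elements of $J_\Delta$. Let $\Delta^{\mathrm{clique}}$ be the clique complex of $\Delta$, whose faces are the subsets of $[m]$ all of whose $n$-element subsets are faces of $\Delta$. A $1$-nonface of a simplicial complex $\Gamma$ is a set $\sigma=\{\sigma_1<\cdots<\sigma_\ell\}\notin\Gamma$ such that $\sigma\setminus\{\sigma_j\}\in\Gamma$ and $\sigma\setminus\{\sigma_{j+1}\}\in\Gamma$ for some $1\le j<\ell$. Assume that $\Delta^{\mathrm{clique}}$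 has no $1$-nonfaces of cardinality $n+1$ (this holds in particular if $\Delta$ itself has none). Then for all $i\ge 1$, $$\beta_{i,n+i}(J_\Delta)=\beta_{i,n+i}(\operatorname{in}_<(J_\Delta)),$$ where, for a homogeneous ideal $I$, $\beta_{i,j}(I)$ is the number of basis elements of degree $j$ in homological degree $i$ of a minimal graded free resolution of $I$ as an $R$-module. -/

import Mathlib

namespace DetFacet

/-! ### Simplicial complexes on the vertices `Fin m` (that is, `1, …, m`)

A simplicial complex is Mathlib's `PreAbstractSimplicialComplex (Fin m)`, a downward closed set of
nonempty finite sets; the empty face is left implicit and vertices outside the complex are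
allowed. -/

/-- The facets, i.e. the inclusion-maximal faces. -/
def IsFacet {m : ℕ} (Δ : PreAbstractSimplicialComplex (Fin m)) (σ : Finset (Fin m)) : Prop :=
  Maximal (fun τ => τ ∈ Δ) σ

/-- `Δ` is `(n-1)`-pure: every facet has exactly `n` vertices. -/
def IsPureCard {m : ℕ} (n : ℕ) (Δ : PreAbstractSimplicialComplex (Fin m)) : Prop :=
  ∀ σ, IsFacet Δ σ → σ.card = n

/-- The clique complex of an `(n-1)`-pure complex: its faces are the cliques, i.e. the sets all of
whose `n`-element subsets are faces of `Δ`. -/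
def cliqueComplex {m : ℕ} (n : ℕ) (Δ : PreAbstractSimplicialComplex (Fin m)) :
    PreAbstractSimplicialComplex (Fin m) where
  faces := {σ | σ.Nonempty ∧ ∀ τ ⊆ σ, τ.card = n → τ ∈ Δ}
  isRelLowerSet_faces := fun _ hσ =>
    ⟨hσ.1, fun _ hτσ hτ => ⟨hτ, fun ρ hρ hc => hσ.2 ρ (hρ.trans hτσ) hc⟩⟩

/-- `σ = {σ_0 < ⋯ < σ_{ℓ-1}}` is an `i`-nonface of `Δ`: it is not a face, and there are `i + 1`
consecutive elements `σ_j, …, σ_{j+i}` of `σ` such that deleting any one of them gives a face. -/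
def IsINonface {m : ℕ} (Δ : PreAbstractSimplicialComplex (Fin m)) (i : ℕ) (σ : Finset (Fin m)) :
    Prop :=
  σ ∉ Δ ∧ ∃ (j : ℕ) (h : j + i < σ.card), ∀ (k : ℕ) (hk : k ≤ i),
    σ.erase (σ.orderEmbOfFin rfl ⟨j + k, by omega⟩) ∈ Δ

/-- If `Δ` has no `1`-nonface of cardinality `n + 1`, then neither has its clique complex. So a
hypothesis on the clique complex is the weaker one. -/
theorem cliqueComplex_no_oneNonface {m n : ℕ} (hn : 1 ≤ n)
    {Δ : PreAbstractSimplicialComplex (Fin m)}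
    (h : ∀ σ : Finset (Fin m), σ.card = n + 1 → ¬ IsINonface Δ 1 σ)
    (σ : Finset (Fin m)) (hσ : σ.card = n + 1) : ¬ IsINonface (cliqueComplex n Δ) 1 σ := by
  rintro ⟨hnot, j, hj, hk⟩
  refine h σ hσ ⟨fun hmem => hnot ⟨?_, fun τ hτ hc => ?_⟩, j, hj, fun k hk' => ?_⟩
  · exact Finset.card_pos.mp (by omega)
  · exact (Δ.isRelLowerSet_faces hmem).2 hτ (Finset.card_pos.mp (by omega))
  · refine (hk k hk').2 _ subset_rfl ?_
    rw [Finset.card_erase_of_mem (Finset.orderEmbOfFin_mem σ rfl _), hσ]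
    rfl

/-! ### Determinantal facet ideals and initial ideals -/

/-- `R = k[x_{ij}]`, `1 ≤ i ≤ n`, `1 ≤ j ≤ m`. The index type carries the lexicographic order, so
that the variables are ordered `x_{11} > x_{12} > ⋯ > x_{1m} > x_{21} > ⋯ > x_{nm}`. -/
abbrev PolyRing (k : Type*) [Field k] (n m : ℕ) : Type _ := MvPolynomial (Fin n ×ₗ Fin m) k

/-- The generic `n × m` matrix `(x_{ij})`. -/
noncomputable def genericMatrix (k : Type*) [Field k] (n m : ℕ) :
    Matrix (Fin n) (Fin m) (PolyRing k n m) :=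
  Matrix.of fun i j => MvPolynomial.X (toLex (i, j))

/-- The maximal minor of the generic matrix on the columns in `σ`, taken in increasing order. -/
noncomputable def maximalMinor (k : Type*) [Field k] {n m : ℕ} (σ : Finset (Fin m))
    (hσ : σ.card = n) : PolyRing k n m :=
  ((genericMatrix k n m).submatrix id (σ.orderEmbOfFin hσ)).det

/-- The `n`-determinantal facet ideal `J_Δ`, generated by the maximal minors on the facets. -/
noncomputable def facetIdeal (k : Type*) [Field k] (n : ℕ) {m : ℕ}
    (Δ : PreAbstractSimplicialComplex (Fin m)) : Ideal (PolyRing k n m) :=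
  Ideal.span {p | ∃ (σ : Finset (Fin m)) (_ : IsFacet Δ σ) (hσ : σ.card = n),
    p = maximalMinor k σ hσ}

/-- The initial ideal of `I`, generated by the leading terms of all elements of `I` with respect
to the lexicographic order. -/
noncomputable def initialIdeal {k : Type*} [Field k] {n m : ℕ} (I : Ideal (PolyRing k n m)) :
    Ideal (PolyRing k n m) :=
  Ideal.span ((MonomialOrder.lex (σ := Fin n ×ₗ Fin m)).leadingTerm '' (I : Set (PolyRing k n m)))

/-! ### Minimal graded free resolutions and graded Betti numbers -/

/-- The element `v` of the graded free module `⨁_b S(-deg b)` over the standard graded polynomial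
ring `S = k[x_s : s ∈ ι]` is homogeneous of degree `j`. -/
def IsHomogeneousVec {k ι : Type*} [Field k] {r : ℕ} (deg : Fin r → ℕ)
    (v : Fin r → MvPolynomial ι k) (j : ℕ) : Prop :=
  ∀ b, ∀ e ∈ (v b).support, e.degree + deg b = j

/-- A minimal graded free resolution
`⋯ → F_2 → F_1 → F_0 → I → 0` of an ideal `I` of the standard graded polynomial ring, with
`F_i = ⨁_b S(-deg i b)` of finite rank. -/
structure MinimalGradedFreeResolution {k ι : Type*} [Field k] (I : Ideal (MvPolynomial ι k)) where
  /-- the rank of `F_i` -/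
  rank : ℕ → ℕ
  /-- the degrees of the basis elements of `F_i` -/
  deg : ∀ i, Fin (rank i) → ℕ
  /-- the augmentation `F_0 → I ⊆ S` -/
  aug : (Fin (rank 0) → MvPolynomial ι k) →ₗ[MvPolynomial ι k] MvPolynomial ι k
  /-- the differential `F_{i+1} → F_i` -/
  d : ∀ i, (Fin (rank (i + 1)) → MvPolynomial ι k) →ₗ[MvPolynomial ι k]
    (Fin (rank i) → MvPolynomial ι k)
  /-- the augmentation preserves degrees -/
  aug_homogeneous : ∀ a, (aug (Pi.single a 1)).IsHomogeneous (deg 0 a)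
  /-- the differentials preserve degrees -/
  d_homogeneous : ∀ i a, IsHomogeneousVec (deg i) (d i (Pi.single a 1)) (deg (i + 1) a)
  range_aug : LinearMap.range aug = I
  exact_aug : Function.Exact (d 0) aug
  exact_d : ∀ i, Function.Exact (d (i + 1)) (d i)
  /-- minimality: the image of each differential lies in `𝔪 F_i`, where `𝔪` is the ideal of
  polynomials without constant term -/
  minimal : ∀ i v b, MvPolynomial.constantCoeff (d i v b) = 0

/-- The graded Betti number `β_{i,j}(I)`, read off from a minimal graded free resolution: the
number of basis elements of degree `j` in `F_i`. -/
def MinimalGradedFreeResolution.betti {k ι : Type*} [Field k] {I : Ideal (MvPolynomial ι k)}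
    (F : MinimalGradedFreeResolution I) (i j : ℕ) : ℕ :=
  (Finset.univ.filter fun b => F.deg i b = j).card

end DetFacet

/-! Both ideals vanish below degree `n`. For such an ideal `I`, `β_{i,n+i}(I)` is the dimension of
`Tor_i(I, k)` in degree `n + i`. In the Koszul complex there are no boundaries in that degree,
because `I` has nothing in degree `n - 1`. So the Betti number is the dimension of the space of
Koszul cycles in `⋀^i V ⊗ I_n`, with `V` the span of the variables (`betti_eq_finrank_koszulCycles`,
obtained directly from the linear strand of the given resolution). For `J_Δ` and for its initial
ideal this dimension is the number of block sets (`finrank_koszulCycles_eq`).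

Upper bound: the leading monomial of a nonzero element of degree `n` of either ideal is a diagonal
`x_{1,s_1} ⋯ x_{n,s_n}` with `s` a face. In the lex-largest multidegree of a nonzero cycle only
leading monomials survive. There the cycle equation forces exchanges of two variables in the same
row (`exchange`), and these reach every transversal (`exists_of_transversal`). Hence that
multidegree is squarefree, its rows proceed from left to right, and all its transversals are faces;
the absence of `1`-nonfaces makes its columns a clique (`face_of_transversals`). One coefficient per
block set therefore detects every nonzero cycle (`blockCoeff_injective`).

Lower bound: the Eagon–Northcott complex gives a cycle for each block set `U`. Its values are zero
or signed maximal minors on columns of `U`, which lie in `J_Δ` because these columns form a clique.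
Among multidegrees with the row and column sums of `U`, the largest is `U` itself (`lex_le_setExp`),
and it occurs with coefficient `1`. The component in multidegree `U` consists of leading terms, so
it is a cycle for the initial ideal. Distinct largest multidegrees give linear independence for both
ideals (`linearIndependent_of_triangular`). -/

namespace DetFacet

open MvPolynomial

/-! ### Polynomials of small degree -/

section Order

variable {k ι : Type*} [Field k]

/-- All monomials of `p` have degree at least `d`. -/
def OrderGE (d : ℕ) (p : MvPolynomial ι k) : Prop :=
  ∀ e : ι →₀ ℕ, e.degree < d → coeff e p = 0

/-- Any nonconstant term of `p` pushes the degree of a product term above `d`. This is what reduces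
lowest-degree questions to linear algebra over `k`. -/
theorem OrderGE.coeff_mul_of_degree_le {d : ℕ} {q : MvPolynomial ι k} (hq : OrderGE d q)
    (p : MvPolynomial ι k) {e : ι →₀ ℕ} (he : e.degree ≤ d) :
    coeff e (p * q) = constantCoeff p * coeff e q := by
  classical
  rw [coeff_mul, Finset.sum_eq_single (0, e)]
  · rfl
  · rintro ⟨a, b⟩ hab hne
    rw [Finset.HasAntidiagonal.mem_antidiagonal] at hab
    simp only at hab ⊢
    have hdeg : a.degree + b.degree = e.degree := by rw [← hab, map_add]
    have ha : a ≠ 0 := by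
      rintro rfl
      exact hne (by simpa using hab)
    have : a.degree ≠ 0 := fun h => ha ((Finsupp.degree_eq_zero_iff a).1 h)
    rw [hq b (by omega), mul_zero]
  · intro h
    simp at h

theorem OrderGE.mul_left {d : ℕ} {q : MvPolynomial ι k} (hq : OrderGE d q)
    (p : MvPolynomial ι k) : OrderGE d (p * q) := fun e he => by
  rw [hq.coeff_mul_of_degree_le p he.le, hq e he, mul_zero]

theorem orderGE_one_iff {p : MvPolynomial ι k} : OrderGE 1 p ↔ constantCoeff p = 0 := by
  refine ⟨fun h => h 0 (by simp), fun h e he => ?_⟩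
  have : e = 0 := (Finsupp.degree_eq_zero_iff e).1 (by omega)
  subst this
  exact h

theorem exists_single_of_degree_eq_one {e : ι →₀ ℕ} (he : e.degree = 1) :
    ∃ w, e = Finsupp.single w 1 := by
  obtain ⟨w, hw⟩ : ∃ w, e w ≠ 0 := by
    by_contra! h
    have : e = 0 := Finsupp.ext h
    simp [this] at he
  refine ⟨w, ?_⟩
  have hle : Finsupp.single w 1 ≤ e := by
    rw [Finsupp.single_le_iff]; omega
  have hs := tsub_add_cancel_of_le hle
  have hd : (e - Finsupp.single w 1).degree + 1 = 1 := by
    conv_rhs => rw [← he, ← hs]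
    simp
  have h0 : e - Finsupp.single w 1 = 0 := (Finsupp.degree_eq_zero_iff _).1 (by omega)
  rw [h0, zero_add] at hs
  exact hs.symm

variable [Fintype ι]

theorem eq_sum_X_of_linear {p : MvPolynomial ι k} (hp : ∀ e ∈ p.support, e.degree = 1) :
    p = ∑ w, X w * C (coeff (Finsupp.single w 1) p) := by
  classical
  ext e
  rw [coeff_sum]
  simp only [mul_comm (X _), coeff_C_mul, coeff_X]
  by_cases he : e.degree = 1
  · obtain ⟨w, rfl⟩ := exists_single_of_degree_eq_one he
    rw [Finset.sum_eq_single w]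
    · simp
    · intro v _ hv
      rw [if_neg, mul_zero]
      exact fun h => hv (Finsupp.single_left_injective one_ne_zero h)
    · simp
  · rw [notMem_support_iff.1 (fun h => he (hp e h))]
    symm
    refine Finset.sum_eq_zero fun w _ => ?_
    rw [if_neg, mul_zero]
    rintro rfl
    simp at he

theorem coeff_single_sum_X_mul_C (y : ι → k) (w : ι) :
    coeff (Finsupp.single w 1) (∑ v, X v * C (y v)) = y w := by
  classical
  rw [coeff_sum, Finset.sum_eq_single w]
  · simp [mul_comm (X _)]
  · intro v _ hv
    rw [mul_comm, coeff_C_mul, coeff_X, if_neg, mul_zero]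
    exact fun h => hv (Finsupp.single_left_injective one_ne_zero h)
  · simp

/-- Only the pairs `(v, w)` and `(w, v)` contribute to `x_v x_w`. The diagonal case is separate so
that characteristic `2` is covered. -/
theorem coeff_sum_X_mul_X (a : ι → ι → k) (h : ∑ v, X v * ∑ w, X w * C (a v w) = 0) :
    (∀ v, a v v = 0) ∧ ∀ v w, v ≠ w → a v w = - a w v := by
  classical
  have key : ∀ v w, ∑ p : ι × ι, (if Finsupp.single p.1 1 + Finsupp.single p.2 1 =
      Finsupp.single v 1 + Finsupp.single w (1 : ℕ) then a p.1 p.2 else 0) = 0 := by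
    intro v w
    have := congrArg (coeff (Finsupp.single v 1 + Finsupp.single w 1)) h
    simp only [Finset.mul_sum, coeff_sum, coeff_zero] at this
    rw [← Finset.univ_product_univ, Finset.sum_product]
    refine Eq.trans ?_ this
    refine Finset.sum_congr rfl fun x _ => Finset.sum_congr rfl fun y _ => ?_
    have : (X x * (X y * C (a x y)) : MvPolynomial ι k) =
        monomial (Finsupp.single x 1 + Finsupp.single y 1) (a x y) := by
      rw [← mul_assoc, X, X, monomial_mul, mul_comm, C_mul_monomial]
      simp
    rw [this, coeff_monomial]
  have hiff : ∀ (p : ι × ι) v w, (Finsupp.single p.1 1 + Finsupp.single p.2 1 =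
      Finsupp.single v 1 + Finsupp.single w (1 : ℕ)) ↔ p = (v, w) ∨ p = (w, v) := by
    rintro ⟨x, y⟩ v w
    rw [Finsupp.single_add_single_eq_single_add_single one_ne_zero one_ne_zero]
    simp
  simp only [hiff] at key
  refine ⟨fun v => ?_, fun v w hvw => ?_⟩
  · simpa using key v v
  · have := key v w
    rw [← Finset.sum_filter, Finset.filter_or, Finset.sum_union] at this
    · simp only [Finset.filter_eq', Finset.mem_univ, if_true, Finset.sum_singleton] at this
      exact eq_neg_of_add_eq_zero_left this
    · rw [Finset.disjoint_filter]
      rintro x _ rfl h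
      exact hvw (congrArg Prod.fst h)

end Order

/-! ### Koszul cycles -/

section Koszul

variable {k ι : Type*} [Field k] [Fintype ι]

/-- Koszul cycles `∑ e_{v_1} ∧ ⋯ ∧ e_{v_i} ⊗ c (v_1, …, v_i)` with coefficients in a space `P` of
polynomials, written as alternating functions of the indices of the variables. -/
def koszulCycles (P : Submodule k (MvPolynomial ι k)) (i : ℕ) :
    Submodule k ((Fin i → ι) → MvPolynomial ι k) where
  -- Vanishing on repeated indices does not follow from antisymmetry in characteristic `2`. The last
  -- condition is the Koszul differential, contracted in slot `j`.
  carrier := {c | (∀ v, c v ∈ P) ∧ (∀ v a b, a ≠ b → v a = v b → c v = 0) ∧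
    (∀ v a b, a ≠ b → c (v ∘ Equiv.swap a b) = - c v) ∧
    ∀ v j, ∑ w, X w * c (Function.update v j w) = 0}
  zero_mem' := by simp
  add_mem' := by
    rintro c c' ⟨h1, h2, h3, h4⟩ ⟨h1', h2', h3', h4'⟩
    refine ⟨fun v => P.add_mem (h1 v) (h1' v), fun v a b hab hv => ?_, fun v a b hab => ?_,
      fun v j => ?_⟩
    · rw [Pi.add_apply, h2 v a b hab hv, h2' v a b hab hv, add_zero]
    · rw [Pi.add_apply, Pi.add_apply, h3 v a b hab, h3' v a b hab, neg_add]
    · simp only [Pi.add_apply, mul_add, Finset.sum_add_distrib, h4 v j, h4' v j, add_zero]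
  smul_mem' := by
    rintro r c ⟨h1, h2, h3, h4⟩
    refine ⟨fun v => P.smul_mem r (h1 v), fun v a b hab hv => ?_, fun v a b hab => ?_,
      fun v j => ?_⟩
    · rw [Pi.smul_apply, h2 v a b hab hv, smul_zero]
    · rw [Pi.smul_apply, Pi.smul_apply, h3 v a b hab, smul_neg]
    · simp only [Pi.smul_apply, mul_smul_comm, ← Finset.smul_sum, h4 v j, smul_zero]

theorem cons_comp_swap_succ {ι : Type*} {i : ℕ} (w : ι) (v : Fin i → ι) (a b : Fin i) :
    (Fin.cons w v : Fin (i + 1) → ι) ∘ Equiv.swap a.succ b.succ =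
      Fin.cons w (v ∘ Equiv.swap a b) := by
  funext x
  refine Fin.cases ?_ (fun y => ?_) x
  · rw [Function.comp_apply, Equiv.swap_apply_of_ne_of_ne (Fin.succ_ne_zero a).symm
      (Fin.succ_ne_zero b).symm]
    rfl
  · have : Equiv.swap a.succ b.succ y.succ = (Equiv.swap a b y).succ := by
      rw [Equiv.swap_apply_def, Equiv.swap_apply_def]
      simp only [Fin.succ_inj]
      split_ifs <;> rfl
    simp [this]

theorem cons_cons_comp_swap {ι : Type*} {i : ℕ} (x y : ι) (v : Fin i → ι) :
    (Fin.cons x (Fin.cons y v : Fin (i + 1) → ι) : Fin (i + 2) → ι) ∘ Equiv.swap 0 1 =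
      Fin.cons y (Fin.cons x v : Fin (i + 1) → ι) := by
  funext z
  refine Fin.cases ?_ (fun z => ?_) z
  · simp only [Function.comp_apply, Equiv.swap_apply_left, Fin.cons_zero]
    exact Fin.cons_succ (α := fun _ => ι) x _ 0
  · refine Fin.cases ?_ (fun z => ?_) z
    · have : Fin.succ (0 : Fin (i + 1)) = 1 := rfl
      rw [Function.comp_apply, this, Equiv.swap_apply_right, ← this]
      simp
    · rw [Function.comp_apply, Equiv.swap_apply_of_ne_of_ne]
      · simp
      · exact Fin.succ_ne_zero _
      · intro h
        exact Fin.succ_ne_zero z (Fin.succ_injective _ h)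

theorem koszulCycles_cons {P : Submodule k (MvPolynomial ι k)} {i : ℕ}
    {c : (Fin (i + 1) → ι) → MvPolynomial ι k} (hc : c ∈ koszulCycles P (i + 1)) (w : ι) :
    (fun v => c (Fin.cons w v)) ∈ koszulCycles P i := by
  obtain ⟨h1, h2, h3, h4⟩ := hc
  refine ⟨fun v => h1 _, fun v a b hab hv => ?_, fun v a b hab => ?_, fun v j => ?_⟩
  · exact h2 _ a.succ b.succ (fun h => hab (Fin.succ_injective _ h)) (by simpa using hv)
  · have := h3 (Fin.cons w v) a.succ b.succ (fun h => hab (Fin.succ_injective _ h))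
    rwa [cons_comp_swap_succ] at this
  · have := h4 (Fin.cons w v) j.succ
    simpa only [← Fin.cons_update] using this

/-- Koszul cycles of length `i + 2` are families of Koszul cycles of length `i + 1` that alternate
in the first two arguments. -/
theorem koszulCycles_of_cons {P : Submodule k (MvPolynomial ι k)} {i : ℕ}
    {c : (Fin (i + 2) → ι) → MvPolynomial ι k}
    (hc : ∀ w, (fun v => c (Fin.cons w v)) ∈ koszulCycles P (i + 1))
    (hdiag : ∀ x v, c (Fin.cons x (Fin.cons x v : Fin (i + 1) → ι)) = 0)
    (hswap : ∀ x y v, x ≠ y → c (Fin.cons x (Fin.cons y v : Fin (i + 1) → ι)) =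
      - c (Fin.cons y (Fin.cons x v : Fin (i + 1) → ι))) :
    c ∈ koszulCycles P (i + 2) := by
  have swap_succ : ∀ v (a b : Fin (i + 1)), a ≠ b →
      c (v ∘ Equiv.swap a.succ b.succ) = - c v := by
    intro v a b hab
    rw [← Fin.cons_self_tail v, cons_comp_swap_succ]
    exact (hc (v 0)).2.2.1 _ a b hab
  have swap01 : ∀ v, c (v ∘ Equiv.swap 0 1) = - c v := by
    intro v
    rw [← Fin.cons_self_tail v, ← Fin.cons_self_tail (Fin.tail v), cons_cons_comp_swap]
    by_cases h : Fin.tail v 0 = v 0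
    · rw [h, hdiag, neg_zero]
    · exact hswap _ _ _ h
  have h01 : ∀ v : Fin (i + 2) → ι, v 0 = v 1 → c v = 0 := by
    intro v hv
    rw [← Fin.cons_self_tail v, ← Fin.cons_self_tail (Fin.tail v)]
    have : Fin.tail v 0 = v 0 := by rw [hv]; rfl
    rw [this]
    exact hdiag _ _
  have swap0 : ∀ v (b : Fin (i + 1)), c (v ∘ Equiv.swap 0 b.succ) = - c v := by
    intro v b
    by_cases hb : b = 0
    · subst hb
      exact swap01 v
    -- Conjugation writes this transposition through `(0 1)` and a transposition of the tail, both
    -- already handled.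
    · have hs : (Equiv.swap 0 b.succ : Equiv.Perm (Fin (i + 2))) =
          Equiv.swap (Fin.succ 0) b.succ * Equiv.swap 0 (Fin.succ 0) *
            Equiv.swap (Fin.succ 0) b.succ := by
        rw [Equiv.swap_mul_swap_mul_swap (Fin.succ_ne_zero _).symm (Fin.succ_ne_zero _).symm,
          Equiv.swap_comm]
      rw [hs, Equiv.Perm.coe_mul, ← Function.comp_assoc, swap_succ _ _ _ (Ne.symm hb),
        Equiv.Perm.coe_mul, ← Function.comp_assoc]
      have := swap01 (v ∘ Equiv.swap (Fin.succ 0) b.succ)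
      rw [show (1 : Fin (i + 2)) = Fin.succ 0 from rfl] at this
      rw [this, swap_succ _ _ _ (Ne.symm hb), neg_neg]
  have h0 : ∀ (v : Fin (i + 2) → ι) (b : Fin (i + 1)), v 0 = v b.succ → c v = 0 := by
    intro v b hv
    by_cases hb : b = 0
    · subst hb
      exact h01 v hv
    · rw [← neg_eq_zero, ← swap_succ v 0 b (Ne.symm hb)]
      refine h01 _ ?_
      rw [Function.comp_apply, Function.comp_apply, Equiv.swap_apply_of_ne_of_ne
        (Fin.succ_ne_zero _).symm (Fin.succ_ne_zero _).symm, hv,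
        show (1 : Fin (i + 2)) = Fin.succ 0 from rfl, Equiv.swap_apply_left]
  have hsucc : ∀ v (j : Fin (i + 1)), ∑ w, X w * c (Function.update v j.succ w) = 0 := by
    intro v j
    rw [← Fin.cons_self_tail v]
    simp only [← Fin.cons_update]
    exact (hc (v 0)).2.2.2 (Fin.tail v) j
  refine ⟨fun v => ?_, fun v a b hab hv => ?_, fun v a b hab => ?_, fun v j => ?_⟩
  · rw [← Fin.cons_self_tail v]
    exact (hc (v 0)).1 _
  · induction a using Fin.cases with
    | zero =>
      induction b using Fin.cases with
      | zero => exact absurd rfl hab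
      | succ b => exact h0 v b hv
    | succ a =>
      induction b using Fin.cases with
      | zero => exact h0 v a hv.symm
      | succ b =>
        rw [← Fin.cons_self_tail v]
        exact (hc (v 0)).2.1 (Fin.tail v) a b (fun h => hab (congrArg _ h)) hv
  · induction a using Fin.cases with
    | zero =>
      induction b using Fin.cases with
      | zero => exact absurd rfl hab
      | succ b => exact swap0 v b
    | succ a =>
      induction b using Fin.cases with
      | zero => rw [Equiv.swap_comm]; exact swap0 v a
      | succ b => exact swap_succ v a b (fun h => hab (congrArg _ h))
  · induction j using Fin.cases with
    | zero =>
      -- A swap moves the contraction from slot `0` to slot `1`, where it is inherited from the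
      -- tail.
      have hup : ∀ w, Function.update v 0 w =
          Function.update (v ∘ Equiv.swap 0 1) (Fin.succ 0) w ∘ Equiv.swap 0 1 := by
        intro w
        have : (Fin.succ 0 : Fin (i + 2)) = Equiv.swap 0 1 0 := by simp
        rw [this, Function.update_comp_equiv]
        simp only [Equiv.symm_swap, Equiv.swap_apply_left, Equiv.swap_apply_right,
          Function.comp_assoc]
        rw [← Equiv.Perm.coe_mul, Equiv.swap_mul_self]
        simp
      simp only [hup, swap01, mul_neg, Finset.sum_neg_distrib, hsucc, neg_zero]
    | succ j => exact hsucc v j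

theorem koszulCycles_comp_perm {P : Submodule k (MvPolynomial ι k)} {i : ℕ}
    {c : (Fin i → ι) → MvPolynomial ι k} (hc : c ∈ koszulCycles P i) (v : Fin i → ι)
    (π : Equiv.Perm (Fin i)) : c (v ∘ π) = c v ∨ c (v ∘ π) = - c v := by
  induction π using Equiv.Perm.swap_induction_on generalizing v with
  | one => left; rfl
  | swap_mul f x y hxy ih =>
    rw [Equiv.Perm.coe_mul, ← Function.comp_assoc]
    have h1 := ih (v ∘ Equiv.swap x y)
    rw [hc.2.2.1 v x y hxy, neg_neg] at h1
    exact h1.symm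

end Koszul

/-! ### The linear strand of a minimal graded free resolution -/

namespace MinimalGradedFreeResolution

variable {k ι : Type*} [Field k] {I : Ideal (MvPolynomial ι k)}

theorem d_apply (F : MinimalGradedFreeResolution I) (i : ℕ)
    (z : Fin (F.rank (i + 1)) → MvPolynomial ι k) (b : Fin (F.rank i)) :
    F.d i z b = ∑ a, z a * F.d i (Pi.single a 1) b := by
  conv_lhs => rw [← Finset.univ_sum_single z, map_sum, Finset.sum_apply]
  refine Finset.sum_congr rfl fun a _ => ?_
  have : (Pi.single a (z a) : Fin (F.rank (i + 1)) → MvPolynomial ι k) =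
      z a • Pi.single a 1 := by
    rw [← Pi.single_smul, smul_eq_mul, mul_one]
  rw [this, map_smul, Pi.smul_apply, smul_eq_mul]

theorem aug_apply (F : MinimalGradedFreeResolution I)
    (z : Fin (F.rank 0) → MvPolynomial ι k) :
    F.aug z = ∑ a, z a * F.aug (Pi.single a 1) := by
  conv_lhs => rw [← Finset.univ_sum_single z, map_sum]
  refine Finset.sum_congr rfl fun a _ => ?_
  have : (Pi.single a (z a) : Fin (F.rank 0) → MvPolynomial ι k) =
      z a • Pi.single a 1 := by
    rw [← Pi.single_smul, smul_eq_mul, mul_one]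
  rw [this, map_smul, smul_eq_mul]

theorem aug_mem (F : MinimalGradedFreeResolution I)
    (z : Fin (F.rank 0) → MvPolynomial ι k) : F.aug z ∈ I :=
  F.range_aug.le (LinearMap.mem_range_self _ _)

theorem single_ne_d (F : MinimalGradedFreeResolution I) (i : ℕ) (a : Fin (F.rank i))
    (z : Fin (F.rank (i + 1)) → MvPolynomial ι k) : F.d i z ≠ Pi.single a 1 := fun h => by
  have := F.minimal i z a
  simp [h] at this

/-- The basis elements of the `i`-th step have degree at least `n + i`. -/
theorem le_deg (F : MinimalGradedFreeResolution I) {n : ℕ} (hI : ∀ p ∈ I, OrderGE n p)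
    (i : ℕ) (a : Fin (F.rank i)) : n + i ≤ F.deg i a := by
  induction i with
  | zero =>
    by_contra! hlt
    -- A basis element of too small degree has nowhere to go, so it is a cycle; by exactness it is
    -- then a boundary, which minimality forbids.
    have hz : F.aug (Pi.single a 1) = 0 := by
      ext e
      by_cases he : e.degree = F.deg 0 a
      · rw [hI _ (F.aug_mem _) e (by omega), coeff_zero]
      · rw [(F.aug_homogeneous a).coeff_eq_zero he, coeff_zero]
    obtain ⟨z, hz⟩ := (F.exact_aug _).1 hz
    exact F.single_ne_d 0 a z hz
  | succ i ih =>
    by_contra! hlt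
    have hz : F.d i (Pi.single a 1) = 0 := by
      funext b
      ext e
      by_contra hne
      have hdeg := F.d_homogeneous i a b e (mem_support_iff.2 hne)
      have := ih b
      have he : e = 0 := (Finsupp.degree_eq_zero_iff e).1 (by omega)
      subst he
      exact hne (F.minimal i _ b)
    have hz' : ∃ z, F.d (i + 1) z = Pi.single a 1 := (F.exact_d i _).1 hz
    obtain ⟨z, hz⟩ := hz'
    exact F.single_ne_d (i + 1) a z hz

/-- The degree `n + i` part of the `k`-span of the basis of the `i`-th step. -/
abbrev Strand (F : MinimalGradedFreeResolution I) (n i : ℕ) : Type _ :=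
  {a : Fin (F.rank i) // F.deg i a = n + i} → k

theorem finrank_strand (F : MinimalGradedFreeResolution I) (n i : ℕ) :
    Module.finrank k (F.Strand n i) = F.betti i (n + i) := by
  rw [Module.finrank_fintype_fun_eq_card, Fintype.card_subtype]
  rfl

open Classical in
/-- The inclusion of the linear strand. -/
noncomputable def incl (F : MinimalGradedFreeResolution I) (n i : ℕ) :
    F.Strand n i →ₗ[k] (Fin (F.rank i) → MvPolynomial ι k) where
  toFun z a := if h : F.deg i a = n + i then C (z ⟨a, h⟩) else 0
  map_add' z z' := by
    funext a
    by_cases h : F.deg i a = n + i <;> simp [h]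
  map_smul' r z := by
    funext a
    by_cases h : F.deg i a = n + i <;> simp [h, smul_eq_C_mul]

theorem incl_apply_of_eq (F : MinimalGradedFreeResolution I) {n i : ℕ} (z : F.Strand n i)
    {a : Fin (F.rank i)} (h : F.deg i a = n + i) : F.incl n i z a = C (z ⟨a, h⟩) := by
  simp [incl, h]

theorem incl_apply_of_ne (F : MinimalGradedFreeResolution I) {n i : ℕ} (z : F.Strand n i)
    {a : Fin (F.rank i)} (h : F.deg i a ≠ n + i) : F.incl n i z a = 0 := by
  simp [incl, h]

/-- The coefficient of the variable `w` in the differential of the linear strand. -/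
noncomputable def strandD (F : MinimalGradedFreeResolution I) (n i : ℕ) (w : ι) :
    F.Strand n (i + 1) →ₗ[k] F.Strand n i where
  toFun z b := coeff (Finsupp.single w 1) (F.d i (F.incl n (i + 1) z) b)
  map_add' z z' := by
    funext b
    simp
  map_smul' r z := by
    funext b
    have : (r • F.incl n (i + 1) z) = (C r : MvPolynomial ι k) • F.incl n (i + 1) z := by
      funext a
      simp [smul_eq_C_mul]
    simp only [map_smul, this, Pi.smul_apply, smul_eq_mul, coeff_C_mul, RingHom.id_apply]

theorem strandD_apply (F : MinimalGradedFreeResolution I) {n i : ℕ} (w : ι)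
    (z : F.Strand n (i + 1)) (b : {a : Fin (F.rank i) // F.deg i a = n + i}) :
    F.strandD n i w z b = coeff (Finsupp.single w 1) (F.d i (F.incl n (i + 1) z) b) := rfl

theorem degree_of_coeff_d_incl (F : MinimalGradedFreeResolution I) {n i : ℕ}
    (z : F.Strand n (i + 1)) (b : Fin (F.rank i)) {e : ι →₀ ℕ}
    (he : coeff e (F.d i (F.incl n (i + 1) z) b) ≠ 0) : e.degree + F.deg i b = n + (i + 1) := by
  rw [d_apply, coeff_sum] at he
  obtain ⟨a, -, ha⟩ := Finset.exists_ne_zero_of_sum_ne_zero he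
  by_cases h : F.deg (i + 1) a = n + (i + 1)
  · rw [F.incl_apply_of_eq z h, coeff_C_mul] at ha
    rw [← h]
    exact F.d_homogeneous i a b e (mem_support_iff.2 (right_ne_zero_of_mul ha))
  · simp [F.incl_apply_of_ne z h] at ha

/-- Boundaries lie in `𝔪 F_i` by minimality, whereas the strand consists of vectors of constants. -/
theorem incl_eq_zero_of_mem_range (F : MinimalGradedFreeResolution I) {n i : ℕ}
    {z : F.Strand n i} (h : ∃ y, F.d i y = F.incl n i z) : z = 0 := by
  obtain ⟨y, hy⟩ := h
  funext a
  have := F.minimal i y a.1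
  rw [hy, F.incl_apply_of_eq z a.2] at this
  simpa using this

/-- The degree `n` part of an ideal. -/
noncomputable def degreePart (I : Ideal (MvPolynomial ι k)) (n : ℕ) : Submodule k (MvPolynomial ι k) :=
  I.restrictScalars k ⊓ homogeneousSubmodule ι k n

theorem aug_incl_mem (F : MinimalGradedFreeResolution I) {n : ℕ} (z : F.Strand n 0) :
    F.aug (F.incl n 0 z) ∈ degreePart I n := by
  refine ⟨?_, ?_⟩
  · exact F.aug_mem _
  · rw [aug_apply]
    refine Submodule.sum_mem _ fun a _ => ?_
    by_cases h : F.deg 0 a = n + 0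
    · rw [F.incl_apply_of_eq z h, ← smul_eq_C_mul]
      refine Submodule.smul_mem _ _ ?_
      have := F.aug_homogeneous a
      rwa [h] at this
    · rw [F.incl_apply_of_ne z h, zero_mul]
      exact Submodule.zero_mem _

theorem exists_aug_incl_eq (F : MinimalGradedFreeResolution I) {n : ℕ}
    (hI : ∀ p ∈ I, OrderGE n p) {p : MvPolynomial ι k} (hp : p ∈ degreePart I n) :
    ∃ z : F.Strand n 0, F.aug (F.incl n 0 z) = p := by
  obtain ⟨hpI, hph⟩ := hp
  obtain ⟨Z, rfl⟩ := F.range_aug.ge hpI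
  -- In degree `n` only the constant terms of an arbitrary lift `Z` matter, and only at basis
  -- elements of degree `n`.
  refine ⟨fun a => constantCoeff (Z a), ?_⟩
  have hmem := (F.aug_incl_mem (fun a : {a // F.deg 0 a = n + 0} => constantCoeff (Z a))).2
  ext e
  by_cases he : e.degree = n
  · rw [aug_apply, aug_apply, coeff_sum, coeff_sum]
    refine Finset.sum_congr rfl fun a _ => ?_
    have ho : OrderGE n (F.aug (Pi.single a 1)) := hI _ (F.aug_mem _)
    rw [ho.coeff_mul_of_degree_le _ he.le, ho.coeff_mul_of_degree_le _ he.le]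
    by_cases ha : F.deg 0 a = n + 0
    · rw [F.incl_apply_of_eq _ ha, constantCoeff_C]
    · rw [(F.aug_homogeneous a).coeff_eq_zero (d := e) (by omega), mul_zero, mul_zero]
  · have h1 : (F.aug Z).IsHomogeneous n := hph
    have h2 : (F.aug (F.incl n 0 fun a => constantCoeff (Z a))).IsHomogeneous n := hmem
    rw [h1.coeff_eq_zero he, h2.coeff_eq_zero he]

theorem aug_incl_injective (F : MinimalGradedFreeResolution I) {n : ℕ} {z : F.Strand n 0}
    (h : F.aug (F.incl n 0 z) = 0) : z = 0 :=
  F.incl_eq_zero_of_mem_range ((F.exact_aug _).1 h)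

/-- The Koszul cycle of an element of the linear strand. -/
noncomputable def toCycle (F : MinimalGradedFreeResolution I) (n : ℕ) :
    ∀ i, F.Strand n i →ₗ[k] ((Fin i → ι) → MvPolynomial ι k)
  | 0 => LinearMap.pi fun _ => (F.aug.restrictScalars k).comp (F.incl n 0)
  | i + 1 => LinearMap.pi fun v =>
      (LinearMap.proj (Fin.tail v)).comp ((F.toCycle n i).comp (F.strandD n i (v 0)))

theorem toCycle_zero (F : MinimalGradedFreeResolution I) (n : ℕ) (z : F.Strand n 0)
    (v : Fin 0 → ι) : F.toCycle n 0 z v = F.aug (F.incl n 0 z) := rfl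

theorem toCycle_cons (F : MinimalGradedFreeResolution I) (n i : ℕ) (z : F.Strand n (i + 1))
    (w : ι) (v : Fin i → ι) :
    F.toCycle n (i + 1) z (Fin.cons w v) = F.toCycle n i (F.strandD n i w z) v := rfl

variable [Fintype ι]

/-- A component at a basis element of degree `n + i` is a linear form. At one of larger degree it
could only be a constant, which minimality kills. -/
theorem d_incl (F : MinimalGradedFreeResolution I) {n : ℕ} (hI : ∀ p ∈ I, OrderGE n p) {i : ℕ}
    (z : F.Strand n (i + 1)) :
    F.d i (F.incl n (i + 1) z) =
      ∑ w, (X w : MvPolynomial ι k) • F.incl n i (F.strandD n i w z) := by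
  funext b
  rw [Finset.sum_apply]
  simp only [Pi.smul_apply, smul_eq_mul]
  have hge := F.le_deg hI i b
  by_cases h : F.deg i b = n + i
  · simp only [F.incl_apply_of_eq _ h, strandD_apply]
    refine eq_sum_X_of_linear fun e he => ?_
    have := F.degree_of_coeff_d_incl z b (mem_support_iff.1 he)
    omega
  · simp only [F.incl_apply_of_ne _ h, mul_zero, Finset.sum_const_zero]
    ext e
    by_contra hne
    have := F.degree_of_coeff_d_incl z b hne
    have he : e = 0 := (Finsupp.degree_eq_zero_iff e).1 (by omega)
    subst he
    exact hne (F.minimal i _ b)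

theorem eq_zero_of_strandD_eq_zero (F : MinimalGradedFreeResolution I) {n : ℕ}
    (hI : ∀ p ∈ I, OrderGE n p) {i : ℕ} {z : F.Strand n (i + 1)}
    (h : ∀ w, F.strandD n i w z = 0) : z = 0 := by
  refine F.incl_eq_zero_of_mem_range ((F.exact_d i _).1 ?_)
  rw [F.d_incl hI]
  simp [h]

/-- This is `d ∘ d = 0`, read off at the quadratic monomials. -/
theorem strandD_strandD (F : MinimalGradedFreeResolution I) {n : ℕ}
    (hI : ∀ p ∈ I, OrderGE n p) {i : ℕ} (z : F.Strand n (i + 2)) :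
    (∀ v, F.strandD n i v (F.strandD n (i + 1) v z) = 0) ∧
    ∀ v w, v ≠ w → F.strandD n i w (F.strandD n (i + 1) v z) =
      - F.strandD n i v (F.strandD n (i + 1) w z) := by
  have h0 : F.d i (F.d (i + 1) (F.incl n (i + 2) z)) = 0 := (F.exact_d i _).2 ⟨_, rfl⟩
  rw [F.d_incl hI, map_sum] at h0
  simp only [map_smul, F.d_incl hI] at h0
  have key : ∀ b : {a : Fin (F.rank i) // F.deg i a = n + i}, _ := fun b =>
    coeff_sum_X_mul_X (fun v w => F.strandD n i w (F.strandD n (i + 1) v z) b) (by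
      have := congrFun h0 b.1
      simpa only [Finset.sum_apply, Pi.smul_apply, smul_eq_mul, F.incl_apply_of_eq _ b.2,
        Pi.zero_apply] using this)
  exact ⟨fun v => funext fun b => (key b).1 v, fun v w hvw => funext fun b => (key b).2 v w hvw⟩

/-- A preimage may be truncated to its constant terms: the entries of `d` have no constant term, so
the linear coefficients of `d Z` see nothing else, and homogeneity excludes basis elements of other
degrees. -/
theorem strandD_of_d_eq (F : MinimalGradedFreeResolution I) {n i : ℕ}
    (y : ι → F.Strand n i)
    (h : ∃ Z, F.d i Z = ∑ w, (X w : MvPolynomial ι k) • F.incl n i (y w)) :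
    ∃ z : F.Strand n (i + 1), ∀ w, F.strandD n i w z = y w := by
  obtain ⟨Z, hZ⟩ := h
  refine ⟨fun a => constantCoeff (Z a), fun w => funext fun b => ?_⟩
  have hb := congrArg (coeff (Finsupp.single w 1)) (congrFun hZ b.1)
  simp only [Finset.sum_apply, Pi.smul_apply, smul_eq_mul, F.incl_apply_of_eq _ b.2] at hb
  rw [coeff_single_sum_X_mul_C (fun w => y w b)] at hb
  rw [← hb, strandD_apply, d_apply, d_apply, coeff_sum, coeff_sum]
  refine Finset.sum_congr rfl fun a _ => ?_
  have ho : OrderGE 1 (F.d i (Pi.single a 1) b.1) := orderGE_one_iff.2 (F.minimal i _ _)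
  rw [ho.coeff_mul_of_degree_le _ (by simp), ho.coeff_mul_of_degree_le _ (by simp)]
  by_cases ha : F.deg (i + 1) a = n + (i + 1)
  · rw [F.incl_apply_of_eq _ ha, constantCoeff_C]
  · have : coeff (Finsupp.single w 1) (F.d i (Pi.single a 1) b.1) = 0 := by
      by_contra hne
      have := F.d_homogeneous i a b.1 _ (mem_support_iff.2 hne)
      simp at this
      have := b.2
      omega
    rw [this, mul_zero, mul_zero]

/-- The alternation of `y` says exactly that `∑ x_w y_w` is killed by the differential, so exactness
provides a lift. -/
theorem exists_strandD_eq (F : MinimalGradedFreeResolution I) {n : ℕ}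
    (hI : ∀ p ∈ I, OrderGE n p) {i : ℕ} (y : ι → F.Strand n (i + 1))
    (hdiag : ∀ v, F.strandD n i v (y v) = 0)
    (hswap : ∀ v w, v ≠ w → F.strandD n i w (y v) = - F.strandD n i v (y w)) :
    ∃ z : F.Strand n (i + 2), ∀ w, F.strandD n (i + 1) w z = y w := by
  classical
  refine F.strandD_of_d_eq y ((F.exact_d i _).1 ?_)
  rw [map_sum]
  simp only [map_smul, F.d_incl hI, Finset.smul_sum]
  rw [← Finset.sum_product', Finset.univ_product_univ]
  refine Finset.sum_involution (fun p _ => p.swap) ?_ ?_ (fun _ _ => Finset.mem_univ _)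
    (fun _ _ => Prod.swap_swap _)
  · rintro ⟨v, w⟩ -
    simp only [Prod.swap]
    by_cases hvw : v = w
    · subst hvw
      simp [hdiag]
    · rw [hswap v w hvw, map_neg, smul_neg, smul_neg, smul_comm (X v : MvPolynomial ι k) (X w)]
      simp
  · rintro ⟨v, w⟩ - hne heq
    have : w = v := congrArg Prod.fst heq
    subst this
    simp [hdiag] at hne

theorem exists_strandD_zero_eq (F : MinimalGradedFreeResolution I) {n : ℕ}
    (y : ι → F.Strand n 0)
    (h : ∑ w, X w * F.aug (F.incl n 0 (y w)) = 0) :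
    ∃ z : F.Strand n 1, ∀ w, F.strandD n 0 w z = y w := by
  refine F.strandD_of_d_eq y ((F.exact_aug _).1 ?_)
  rw [map_sum]
  simpa only [map_smul, smul_eq_mul] using h

theorem toCycle_injective (F : MinimalGradedFreeResolution I) {n : ℕ}
    (hI : ∀ p ∈ I, OrderGE n p) (i : ℕ) : Function.Injective (F.toCycle n i) := by
  rw [injective_iff_map_eq_zero]
  induction i with
  | zero => exact fun z hz => F.aug_incl_injective (congrFun hz Fin.elim0)
  | succ i ih =>
    refine fun z hz => F.eq_zero_of_strandD_eq_zero hI fun w => ih _ (funext fun v => ?_)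
    rw [← toCycle_cons, hz]
    rfl

theorem toCycle_mem (F : MinimalGradedFreeResolution I) {n : ℕ}
    (hI : ∀ p ∈ I, OrderGE n p) (i : ℕ) (z : F.Strand n i) :
    F.toCycle n i z ∈ koszulCycles (degreePart I n) i := by
  induction i with
  | zero =>
    exact ⟨fun v => F.aug_incl_mem z, fun v a => a.elim0, fun v a => a.elim0, fun v a => a.elim0⟩
  | succ i ih =>
    cases i with
    | zero =>
      refine ⟨fun v => F.aug_incl_mem _, fun v a b hab => absurd (Subsingleton.elim (α := Fin 1) a b) hab,
        fun v a b hab => absurd (Subsingleton.elim (α := Fin 1) a b) hab, fun v j => ?_⟩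
      have h0 : F.aug (F.d 0 (F.incl n 1 z)) = 0 := (F.exact_aug _).2 ⟨_, rfl⟩
      rw [F.d_incl hI, map_sum] at h0
      simp only [map_smul, smul_eq_mul] at h0
      rw [← h0]
      refine Finset.sum_congr rfl fun w _ => ?_
      have : Function.update v j w = Fin.cons w Fin.elim0 := by
        funext x
        rw [Subsingleton.elim (α := Fin 1) x 0, Subsingleton.elim (α := Fin 1) j 0]
        simp
      rw [this, toCycle_cons, toCycle_zero]
    | succ i =>
      refine koszulCycles_of_cons (fun w => ih (F.strandD n (i + 1) w z)) (fun x v => ?_) (fun x y v hxy => ?_)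
      · rw [toCycle_cons, toCycle_cons, (F.strandD_strandD hI z).1 x, map_zero]
        rfl
      · rw [toCycle_cons, toCycle_cons, (F.strandD_strandD hI z).2 x y hxy, map_neg]
        rfl

theorem exists_toCycle_eq (F : MinimalGradedFreeResolution I) {n : ℕ}
    (hI : ∀ p ∈ I, OrderGE n p) (i : ℕ) {c : (Fin i → ι) → MvPolynomial ι k}
    (hc : c ∈ koszulCycles (degreePart I n) i) : ∃ z, F.toCycle n i z = c := by
  induction i with
  | zero =>
    obtain ⟨z, hz⟩ := F.exists_aug_incl_eq hI (hc.1 Fin.elim0)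
    refine ⟨z, funext fun v => ?_⟩
    rw [toCycle_zero, hz, Subsingleton.elim v]
  | succ i ih =>
    choose y hy using fun w => ih (koszulCycles_cons hc w)
    have hy' : ∀ w v, F.toCycle n i (y w) v = c (Fin.cons w v) := fun w v => congrFun (hy w) v
    suffices h : ∃ z : F.Strand n (i + 1), ∀ w, F.strandD n i w z = y w by
      obtain ⟨z, hz⟩ := h
      refine ⟨z, funext fun v => ?_⟩
      rw [← Fin.cons_self_tail v, toCycle_cons, hz, hy']
    cases i with
    | zero =>
      refine F.exists_strandD_zero_eq y ?_
      rcases isEmpty_or_nonempty ι with hι | ⟨⟨x⟩⟩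
      · exact Finset.sum_eq_zero fun w => isEmptyElim w
      · rw [← hc.2.2.2 (fun _ => x) 0]
        refine Finset.sum_congr rfl fun w _ => ?_
        rw [← toCycle_zero F n (y w) Fin.elim0, hy']
        congr 2
        funext x
        rw [Subsingleton.elim (α := Fin 1) x 0]
        simp
    | succ i =>
      refine F.exists_strandD_eq hI y (fun v => ?_) (fun v w hvw => ?_)
      · refine F.toCycle_injective hI i (funext fun u => ?_)
        rw [← toCycle_cons, hy', map_zero]
        exact hc.2.1 _ 0 1 (by simp) rfl
      · refine F.toCycle_injective hI i (funext fun u => ?_)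
        rw [← toCycle_cons, hy', map_neg, Pi.neg_apply, ← toCycle_cons, hy',
          ← cons_cons_comp_swap, hc.2.2.1 _ 0 1 (by simp)]

/-- Iterating the linear coefficients of the differentials and then augmenting turns a strand
element into a Koszul cycle. Minimality gives injectivity; exactness gives surjectivity, one tensor
slot at a time. -/
theorem betti_eq_finrank_koszulCycles (F : MinimalGradedFreeResolution I) {n : ℕ}
    (hI : ∀ p ∈ I, OrderGE n p) (i : ℕ) :
    F.betti i (n + i) = Module.finrank k (koszulCycles (degreePart I n) i) := by
  rw [← F.finrank_strand n i]
  refine LinearEquiv.finrank_eq (LinearEquiv.ofBijective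
    ((F.toCycle n i).codRestrict _ (F.toCycle_mem hI i)) ⟨?_, ?_⟩)
  · intro z z' h
    exact F.toCycle_injective hI i (congrArg Subtype.val h)
  · rintro ⟨c, hc⟩
    obtain ⟨z, hz⟩ := F.exists_toCycle_eq hI i hc
    exact ⟨z, Subtype.ext hz⟩

end MinimalGradedFreeResolution

/-! ### Exponents of tuples of variables -/

section Exponents

/-- The exponent of the monomial `x_{v_1} ⋯ x_{v_i}`. -/
noncomputable def tupleExp {ι : Type*} {i : ℕ} (v : Fin i → ι) : ι →₀ ℕ :=
  ∑ j, Finsupp.single (v j) 1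

/-- The exponent of the product of the variables in `U`. -/
noncomputable def setExp {ι : Type*} (U : Finset ι) : ι →₀ ℕ :=
  ∑ x ∈ U, Finsupp.single x 1

theorem tupleExp_update {ι : Type*} {i : ℕ} (v : Fin i → ι) (j : Fin i) (w : ι) :
    tupleExp (Function.update v j w) + Finsupp.single (v j) 1 =
      tupleExp v + Finsupp.single w 1 := by
  rw [tupleExp, tupleExp, ← Finset.add_sum_erase _ _ (Finset.mem_univ j),
    ← Finset.add_sum_erase _ (fun j => Finsupp.single (v j) 1) (Finset.mem_univ j)]
  have : ∑ x ∈ Finset.univ.erase j, Finsupp.single (Function.update v j w x) 1 =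
      ∑ x ∈ Finset.univ.erase j, Finsupp.single (v x) (1 : ℕ) :=
    Finset.sum_congr rfl fun x hx => by
      rw [Function.update_of_ne (Finset.ne_of_mem_erase hx)]
  rw [this, Function.update_self]
  abel

variable {ι : Type*} [DecidableEq ι] {i : ℕ}

theorem tupleExp_apply (v : Fin i → ι) (x : ι) :
    tupleExp v x = (Finset.univ.filter fun j => v j = x).card := by
  rw [tupleExp, Finsupp.finsetSum_apply, Finset.card_filter]
  exact Finset.sum_congr rfl fun j _ => Finsupp.single_apply

theorem setExp_apply (U : Finset ι) (x : ι) : setExp U x = if x ∈ U then 1 else 0 := by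
  rw [setExp, Finsupp.finsetSum_apply]
  simp only [Finsupp.single_apply]
  exact Finset.sum_ite_eq' U x fun _ => 1

theorem setExp_injective : Function.Injective (setExp : Finset ι → ι →₀ ℕ) := by
  intro U V h
  ext x
  have := DFunLike.congr_fun h x
  rw [setExp_apply, setExp_apply] at this
  by_cases hU : x ∈ U <;> by_cases hV : x ∈ V <;> simp_all

theorem tupleExp_ne_zero_iff {v : Fin i → ι} {x : ι} : tupleExp v x ≠ 0 ↔ ∃ j, v j = x := by
  rw [tupleExp_apply, Finset.card_ne_zero]
  simp [Finset.Nonempty]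

theorem tupleExp_eq_setExp {v : Fin i → ι} (hv : Function.Injective v) :
    tupleExp v = setExp (Finset.univ.image v) := by
  rw [setExp, Finset.sum_image fun _ _ _ _ h => hv h]
  rfl

theorem exists_perm_of_tupleExp_eq {v v' : Fin i → ι} (hv : Function.Injective v)
    (h : tupleExp v' = tupleExp v) : ∃ π : Equiv.Perm (Fin i), v' = v ∘ π := by
  have h1 : ∀ j, ∃ l, v l = v' j := fun j => by
    rw [← tupleExp_ne_zero_iff, ← h, tupleExp_ne_zero_iff]
    exact ⟨j, rfl⟩
  choose f hf using h1
  have hsurj : Function.Surjective f := fun l => by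
    have : ∃ j, v' j = v l := by
      rw [← tupleExp_ne_zero_iff, h, tupleExp_ne_zero_iff]
      exact ⟨l, rfl⟩
    obtain ⟨j, hj⟩ := this
    exact ⟨j, hv (by rw [hf, hj])⟩
  exact ⟨Equiv.ofBijective f (Finite.surjective_iff_bijective.1 hsurj),
    funext fun j => (hf j).symm⟩

end Exponents

/-! ### Diagonal monomials and exchanges between them -/

section Diagonals

variable {n m : ℕ}

/-- The diagonal positions `(1, s_1), …, (n, s_n)`. -/
def diag (s : Fin n → Fin m) : Fin n → Fin n ×ₗ Fin m := fun r => toLex (r, s r)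

theorem diag_injective (s : Fin n → Fin m) : Function.Injective (diag s) := fun _ _ h =>
  congrArg (fun x => (ofLex x).1) h

theorem diag_update (s : Fin n → Fin m) (r : Fin n) (a : Fin m) :
    diag (Function.update s r a) = Function.update (diag s) r (toLex (r, a)) := by
  funext q
  by_cases h : q = r
  · subst h
    simp [diag]
  · simp [diag, h]

theorem tupleExp_diag_apply (s : Fin n → Fin m) (r : Fin n) (a : Fin m) :
    tupleExp (diag s) (toLex (r, a)) = if s r = a then 1 else 0 := by
  rw [tupleExp_eq_setExp (diag_injective s), setExp_apply]
  refine if_congr ?_ rfl rfl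
  simp only [Finset.mem_image, Finset.mem_univ, true_and, diag]
  constructor
  · rintro ⟨q, hq⟩
    have h1 : q = r := congrArg (fun x => (ofLex x).1) hq
    subst h1
    exact congrArg (fun x => (ofLex x).2) hq
  · rintro rfl
    exact ⟨r, rfl⟩

theorem tupleExp_diag_injective :
    Function.Injective fun s : Fin n → Fin m => tupleExp (diag s) := by
  intro s t h
  funext r
  have := DFunLike.congr_fun h (toLex (r, s r))
  simp only [tupleExp_diag_apply, if_true] at this
  by_contra hne
  rw [if_neg (Ne.symm hne)] at this
  exact one_ne_zero this

/-- Exchange of one variable between a variable times a diagonal monomial. -/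
theorem eq_of_single_add_diag {s s' : Fin n → Fin m} {r : Fin n} {a : Fin m}
    {w : Fin n ×ₗ Fin m} (hw : w ≠ toLex (r, a))
    (h : Finsupp.single w 1 + tupleExp (diag s') =
      Finsupp.single (toLex (r, a)) 1 + tupleExp (diag s)) : w = toLex (r, s r) := by
  obtain ⟨q, b, rfl⟩ : ∃ q b, w = toLex (q, b) := ⟨(ofLex w).1, (ofLex w).2, rfl⟩
  have h1 := DFunLike.congr_fun h (toLex (q, b))
  simp only [Finsupp.add_apply, Finsupp.single_apply, if_true, tupleExp_diag_apply,
    if_neg hw.symm] at h1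
  have hs : s q = b := by
    by_contra hne
    rw [if_neg hne] at h1
    omega
  rw [if_pos hs] at h1
  -- The entry of `s'` in row `q` is new, so on the right it can only be `(r, a)`; hence `q = r`.
  have h2 := DFunLike.congr_fun h (toLex (q, s' q))
  simp only [Finsupp.add_apply, Finsupp.single_apply, if_true, tupleExp_diag_apply] at h2
  have hs' : s' q ≠ b := by
    intro hne
    rw [if_pos hne] at h1
    omega
  have hsq : s q ≠ s' q := by rw [hs]; exact hs'.symm
  rw [if_neg hsq] at h2
  have h3 : toLex (r, a) = toLex (q, s' q) := by
    by_contra hne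
    rw [if_neg hne] at h2
    omega
  have : r = q := congrArg (fun x => (ofLex x).1) h3
  rw [this, hs]

end Diagonals

/-! ### Blocks -/

section Blocks

variable {n m : ℕ}

/-- The columns that meet a set of positions of the matrix. -/
def columns (U : Finset (Fin n ×ₗ Fin m)) : Finset (Fin m) := U.image fun x => (ofLex x).2

theorem mem_columns {U : Finset (Fin n ×ₗ Fin m)} {a : Fin m} :
    a ∈ columns U ↔ ∃ r, toLex (r, a) ∈ U := by
  simp only [columns, Finset.mem_image]
  constructor
  · rintro ⟨x, hx, rfl⟩
    exact ⟨(ofLex x).1, hx⟩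
  · rintro ⟨r, hr⟩
    exact ⟨_, hr, rfl⟩

/-- `s_1 < ⋯ < s_n` are the vertices of a face of `Δ`. -/
def IsFaceTuple (Δ : PreAbstractSimplicialComplex (Fin m)) (s : Fin n → Fin m) : Prop :=
  StrictMono s ∧ Finset.univ.image s ∈ Δ

/-- The sets of `n + i` positions which consist of nonempty pieces of the `n` rows, each to the
right of the preceding one, and whose columns form a clique of `Δ`. -/
structure IsBlockSet (Δ : PreAbstractSimplicialComplex (Fin m)) (i : ℕ)
    (U : Finset (Fin n ×ₗ Fin m)) : Prop where
  card_eq : U.card = n + i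
  row_nonempty : ∀ r, ∃ a, toLex (r, a) ∈ U
  lt_of_lt : ∀ {r q : Fin n} {a b : Fin m}, toLex (r, a) ∈ U → toLex (q, b) ∈ U → r < q → a < b
  face : ∀ ρ ⊆ columns U, ρ.card = n → ρ ∈ Δ

/-- This converts monotonicity of transversals into a comparison of any two positions in different
rows. -/
theorem exists_transversal_through {U : Finset (Fin n ×ₗ Fin m)}
    (hrow : ∀ r, ∃ a, toLex (r, a) ∈ U) {r q : Fin n} {a b : Fin m} (ha : toLex (r, a) ∈ U)
    (hb : toLex (q, b) ∈ U) (hrq : r ≠ q) :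
    ∃ t : Fin n → Fin m, (∀ r, toLex (r, t r) ∈ U) ∧ t r = a ∧ t q = b := by
  choose t ht using hrow
  refine ⟨Function.update (Function.update t r a) q b, fun x => ?_, ?_, by simp⟩
  · by_cases hx : x = q
    · subst hx; simpa using hb
    · rw [Function.update_of_ne hx]
      by_cases hx' : x = r
      · subst hx'; simpa using ha
      · rw [Function.update_of_ne hx']; exact ht x
  · rw [Function.update_of_ne hrq]; simp

theorem exists_orderEmbOfFin_consecutive {T : Finset (Fin m)} {a b : Fin m} (ha : a ∈ T)
    (hb : b ∈ T) (hab : a < b) (hbetween : ∀ x ∈ T, a < x → b ≤ x) :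
    ∃ (j : ℕ) (h : j + 1 < T.card), T.orderEmbOfFin rfl ⟨j, by omega⟩ = a ∧
      T.orderEmbOfFin rfl ⟨j + 1, h⟩ = b := by
  have hra : a ∈ Set.range (T.orderEmbOfFin rfl) := by rw [Finset.range_orderEmbOfFin]; exact ha
  have hrb : b ∈ Set.range (T.orderEmbOfFin rfl) := by rw [Finset.range_orderEmbOfFin]; exact hb
  obtain ⟨x, rfl⟩ := hra
  obtain ⟨y, rfl⟩ := hrb
  have hxy : x < y := (T.orderEmbOfFin rfl).lt_iff_lt.1 hab
  have hlt : x.1 + 1 < T.card := lt_of_le_of_lt hxy y.2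
  refine ⟨x.1, hlt, rfl, le_antisymm ?_ ?_⟩
  · exact (T.orderEmbOfFin rfl).le_iff_le.2 hxy
  · exact hbetween _ (Finset.orderEmbOfFin_mem T rfl _)
      ((T.orderEmbOfFin rfl).lt_iff_lt.2 (Nat.lt_succ_self x.1))

/-- If all transversals of `U` are increasing and are faces of `Δ`, then the columns of `U` form a
clique, provided that the clique complex has no `1`-nonfaces of cardinality `n + 1`. -/
theorem face_of_transversals {Δ : PreAbstractSimplicialComplex (Fin m)} (hn : 1 ≤ n)
    (hnonface : ∀ σ : Finset (Fin m), σ.card = n + 1 → ¬ IsINonface (cliqueComplex n Δ) 1 σ)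
    (U : Finset (Fin n ×ₗ Fin m)) (hrow : ∀ r, ∃ a, toLex (r, a) ∈ U)
    (htr : ∀ t : Fin n → Fin m, (∀ r, toLex (r, t r) ∈ U) → IsFaceTuple Δ t) :
    ∀ ρ ⊆ columns U, ρ.card = n → ρ ∈ Δ := by
  induction U using Finset.strongInduction with
  | H U ih =>
  intro ρ hρ hcard
  have hlt : ∀ {r q : Fin n} {a b : Fin m}, toLex (r, a) ∈ U → toLex (q, b) ∈ U →
      r < q → a < b := by
    intro r q a b ha hb hrq
    obtain ⟨t, ht, rfl, rfl⟩ := exists_transversal_through hrow ha hb hrq.ne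
    exact (htr t ht).1 hrq
  choose t ht using hrow
  by_cases hsingle : ∀ r a b, toLex (r, a) ∈ U → toLex (r, b) ∈ U → a = b
  · have hsub : ρ ⊆ Finset.univ.image t := by
      intro x hx
      obtain ⟨r, hr⟩ := mem_columns.1 (hρ hx)
      exact Finset.mem_image.2 ⟨r, Finset.mem_univ _, hsingle r _ _ (ht r) hr⟩
    have : ρ = Finset.univ.image t := by
      refine Finset.eq_of_subset_of_card_le hsub ?_
      rw [hcard]
      exact Finset.card_image_le.trans (by simp)
    rw [this]
    exact (htr t ht).2
  push Not at hsingle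
  obtain ⟨r, a₀, b₀, ha₀, hb₀, hne₀⟩ := hsingle
  -- Neighbours within one row are also adjacent among all columns of `U`, since the other rows lie
  -- entirely to the left or to the right.
  obtain ⟨a, b, ha, hb, hab, hbetween⟩ : ∃ a b, toLex (r, a) ∈ U ∧ toLex (r, b) ∈ U ∧ a < b ∧
      ∀ x, toLex (r, x) ∈ U → a < x → b ≤ x := by
    let A : Finset (Fin m) := Finset.univ.filter fun x => toLex (r, x) ∈ U
    have hA : A.Nonempty := ⟨a₀, by simpa [A] using ha₀⟩
    have hA' : (A.erase (A.min' hA)).Nonempty := by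
      by_cases h : a₀ = A.min' hA
      · exact ⟨b₀, Finset.mem_erase.2 ⟨fun h' => hne₀ (h.trans h'.symm), by simpa [A] using hb₀⟩⟩
      · exact ⟨a₀, Finset.mem_erase.2 ⟨h, by simpa [A] using ha₀⟩⟩
    have h1 := Finset.min'_mem A hA
    have h2 := Finset.min'_mem _ hA'
    refine ⟨A.min' hA, (A.erase (A.min' hA)).min' hA', ?_, ?_, ?_, ?_⟩
    · exact (Finset.mem_filter.1 h1).2
    · exact (Finset.mem_filter.1 (Finset.mem_of_mem_erase h2)).2
    · exact lt_of_le_of_ne (Finset.min'_le _ _ (Finset.mem_of_mem_erase h2))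
        (Finset.ne_of_mem_erase h2).symm
    · intro x hx hlt
      exact Finset.min'_le _ _ (Finset.mem_erase.2 ⟨hlt.ne', by simpa [A] using hx⟩)
  -- Row `r` keeps `y` when `x` is removed, so the induction hypothesis covers every `ρ` that avoids
  -- `x`.
  have herase : ∀ x y, toLex (r, x) ∈ U → toLex (r, y) ∈ U → x ≠ y →
      ∀ ρ ⊆ columns U, ρ.card = n → x ∉ ρ → ρ ∈ Δ := by
    intro x y hx hy hxy ρ hρ hcard hxρ
    refine ih (U.erase (toLex (r, x))) (Finset.erase_ssubset hx) ?_ ?_ ρ ?_ hcard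
    · intro q
      by_cases hq : q = r
      · subst hq
        refine ⟨y, Finset.mem_erase.2 ⟨fun h => hxy ?_, hy⟩⟩
        exact (congrArg (fun x => (ofLex x).2) h).symm
      · exact ⟨t q, Finset.mem_erase.2 ⟨fun h => hq (congrArg (fun x => (ofLex x).1) h), ht q⟩⟩
    · exact fun t' ht' => htr t' fun q => Finset.mem_of_mem_erase (ht' q)
    · intro z hz
      obtain ⟨q, hq⟩ := mem_columns.1 (hρ hz)
      refine mem_columns.2 ⟨q, Finset.mem_erase.2 ⟨fun h => hxρ ?_, hq⟩⟩
      have : z = x := congrArg (fun x => (ofLex x).2) h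
      rwa [← this]
  by_cases haρ : a ∈ ρ
  swap
  · exact herase a b ha hb hab.ne ρ hρ hcard haρ
  by_cases hbρ : b ∈ ρ
  swap
  · exact herase b a hb ha hab.ne' ρ hρ hcard hbρ
  -- A transversal through `(r, a)` has `n` columns, all different from `b`, so `U` has more than
  -- `n` columns.
  obtain ⟨c, hcU, hcρ⟩ : ∃ c ∈ columns U, c ∉ ρ := by
    by_contra! hall
    have htU : ∀ q, toLex (q, Function.update t r a q) ∈ U := by
      intro q
      by_cases hq : q = r
      · subst hq; simpa using ha
      · rw [Function.update_of_ne hq]; exact ht q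
    have hbt : b ∉ Finset.univ.image (Function.update t r a) := by
      intro h
      obtain ⟨q, -, hq⟩ := Finset.mem_image.1 h
      have hqU := htU q
      rw [hq] at hqU
      rcases lt_trichotomy q r with h | rfl | h
      · exact lt_irrefl _ (hlt hqU hb h)
      · simp at hq
        exact hab.ne hq
      · exact lt_irrefl _ (hlt hb hqU h)
    have hsub : insert b (Finset.univ.image (Function.update t r a)) ⊆ ρ := by
      refine Finset.insert_subset hbρ fun x hx => hall x ?_
      obtain ⟨q, -, rfl⟩ := Finset.mem_image.1 hx
      exact mem_columns.2 ⟨q, htU q⟩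
    have := Finset.card_le_card hsub
    rw [Finset.card_insert_of_notMem hbt,
      Finset.card_image_of_injective _ (htr _ htU).1.injective, Finset.card_univ,
      Fintype.card_fin] at this
    omega
  have hTU : insert c ρ ⊆ columns U := Finset.insert_subset hcU hρ
  have hTcard : (insert c ρ).card = n + 1 := by rw [Finset.card_insert_of_notMem hcρ, hcard]
  have herase_mem : ∀ x y, toLex (r, x) ∈ U → toLex (r, y) ∈ U → x ≠ y → x ∈ ρ →
      (insert c ρ).erase x ∈ cliqueComplex n Δ := by
    intro x y hx hy hxy hxρ
    have hcard' : ((insert c ρ).erase x).card = n := by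
      rw [Finset.card_erase_of_mem (Finset.mem_insert_of_mem hxρ), hTcard]
      rfl
    refine ⟨Finset.card_pos.1 (by omega), fun τ hτ hτc => ?_⟩
    rw [Finset.eq_of_subset_of_card_le hτ (by omega)]
    exact herase x y hx hy hxy _ ((Finset.erase_subset _ _).trans hTU) hcard'
      (Finset.notMem_erase _ _)
  -- Deleting `a` or `b` gives a clique by `herase`. As `a` and `b` are adjacent, failure here would
  -- produce a forbidden `1`-nonface.
  have hT : insert c ρ ∈ cliqueComplex n Δ := by
    by_contra hT
    obtain ⟨j, hj, hja, hjb⟩ := exists_orderEmbOfFin_consecutive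
      (Finset.mem_insert_of_mem haρ) (Finset.mem_insert_of_mem hbρ) hab (T := insert c ρ) (by
        intro x hx hax
        obtain ⟨q, hq⟩ := mem_columns.1 (hTU hx)
        rcases lt_trichotomy q r with h | rfl | h
        · exact absurd (hlt hq ha h) hax.not_gt
        · exact hbetween x hq hax
        · exact (hlt hb hq h).le)
    refine hnonface _ hTcard ⟨hT, j, hj, fun l hl => ?_⟩
    interval_cases l
    · have := herase_mem a b ha hb hab.ne haρ
      rwa [← hja] at this
    · have := herase_mem b a hb ha hab.ne' hbρ
      rwa [← hjb] at this
  exact hT.2 ρ (Finset.subset_insert _ _) hcard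

/-- A block set is the disjoint union of a transversal and a tuple of distinct positions. -/
theorem IsBlockSet.exists_tuple {Δ : PreAbstractSimplicialComplex (Fin m)} {i : ℕ}
    {U : Finset (Fin n ×ₗ Fin m)} (hU : IsBlockSet Δ i U) :
    ∃ p : (Fin i → Fin n ×ₗ Fin m) × (Fin n → Fin m), Function.Injective p.1 ∧
      tupleExp p.1 + tupleExp (diag p.2) = setExp U := by
  choose s hs using hU.row_nonempty
  have hsub : Finset.univ.image (diag s) ⊆ U := by
    intro x hx
    obtain ⟨r, -, rfl⟩ := Finset.mem_image.1 hx
    exact hs r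
  have hcard : (U \ Finset.univ.image (diag s)).card = i := by
    rw [Finset.card_sdiff_of_subset hsub, hU.card_eq,
      Finset.card_image_of_injective _ (diag_injective s)]
    simp
  refine ⟨((U \ Finset.univ.image (diag s)).orderEmbOfFin hcard, s),
    ((U \ Finset.univ.image (diag s)).orderEmbOfFin hcard).injective, ?_⟩
  rw [tupleExp_eq_setExp ((U \ Finset.univ.image (diag s)).orderEmbOfFin hcard).injective,
    tupleExp_eq_setExp (diag_injective s), Finset.image_orderEmbOfFin_univ]
  exact Finset.sum_sdiff hsub

/-- The tuple of positions outside a chosen transversal of a block set. -/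
noncomputable def IsBlockSet.tuple {Δ : PreAbstractSimplicialComplex (Fin m)} {i : ℕ}
    {U : Finset (Fin n ×ₗ Fin m)} (hU : IsBlockSet Δ i U) : Fin i → Fin n ×ₗ Fin m :=
  hU.exists_tuple.choose.1

/-- A transversal of a block set. -/
noncomputable def IsBlockSet.transversal {Δ : PreAbstractSimplicialComplex (Fin m)} {i : ℕ}
    {U : Finset (Fin n ×ₗ Fin m)} (hU : IsBlockSet Δ i U) : Fin n → Fin m :=
  hU.exists_tuple.choose.2

theorem IsBlockSet.tuple_injective {Δ : PreAbstractSimplicialComplex (Fin m)} {i : ℕ}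
    {U : Finset (Fin n ×ₗ Fin m)} (hU : IsBlockSet Δ i U) : Function.Injective hU.tuple :=
  hU.exists_tuple.choose_spec.1

theorem IsBlockSet.tupleExp_add {Δ : PreAbstractSimplicialComplex (Fin m)} {i : ℕ}
    {U : Finset (Fin n ×ₗ Fin m)} (hU : IsBlockSet Δ i U) :
    tupleExp hU.tuple + tupleExp (diag hU.transversal) = setExp U :=
  hU.exists_tuple.choose_spec.2

end Blocks

/-! ### The upper bound -/

section UpperBound

variable {k : Type*} [Field k] {n m i : ℕ} {Δ : PreAbstractSimplicialComplex (Fin m)}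
  {P : Submodule k (PolyRing k n m)} {c : (Fin i → Fin n ×ₗ Fin m) → PolyRing k n m}
  {u : (Fin n ×ₗ Fin m) →₀ ℕ}

/-- In the cycle equation for slot `j`, at the monomial `x_{v_j}` times the diagonal of `s`, the
term `w = v j` is nonzero and must be cancelled by another. That term is again a variable times a
diagonal, so `w` is the entry of `s` in row `r`. In particular `v j` cannot itself lie on the
diagonal of `s`. -/
theorem exchange (hc : c ∈ koszulCycles P i)
    (hsupp : ∀ v e, coeff e (c v) ≠ 0 → tupleExp v + e = u →
      ∃ s, IsFaceTuple Δ s ∧ e = tupleExp (diag s))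
    {v : Fin i → Fin n ×ₗ Fin m} {s : Fin n → Fin m} (hne : coeff (tupleExp (diag s)) (c v) ≠ 0)
    (hu : tupleExp v + tupleExp (diag s) = u) {j : Fin i} {r : Fin n} {a : Fin m}
    (hj : v j = toLex (r, a)) :
    a ≠ s r ∧ ∃ v', coeff (tupleExp (diag (Function.update s r a))) (c v') ≠ 0 ∧
      tupleExp v' + tupleExp (diag (Function.update s r a)) = u := by
  have hker := congrArg (coeff (Finsupp.single (v j) 1 + tupleExp (diag s))) (hc.2.2.2 v j)
  rw [coeff_sum, coeff_zero] at hker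
  obtain ⟨w, hwj, hw⟩ : ∃ w ≠ v j, coeff (Finsupp.single (v j) 1 + tupleExp (diag s))
      (X w * c (Function.update v j w)) ≠ 0 := by
    by_contra! hall
    rw [Finset.sum_eq_single (v j) (fun w _ hw => hall w hw) (by simp)] at hker
    rw [Function.update_eq_self, coeff_X_mul] at hker
    exact hne hker
  rw [coeff_X_mul'] at hw
  split_ifs at hw with hmem
  swap
  · exact absurd rfl hw
  have hle : Finsupp.single w 1 ≤ Finsupp.single (v j) 1 + tupleExp (diag s) := by
    rw [Finsupp.single_le_iff]
    exact Nat.one_le_iff_ne_zero.2 (Finsupp.mem_support_iff.1 hmem)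
  generalize he : Finsupp.single (v j) 1 + tupleExp (diag s) - Finsupp.single w 1 = e at hw
  have he' : Finsupp.single w 1 + e = Finsupp.single (v j) 1 + tupleExp (diag s) := by
    rw [← he, add_tsub_cancel_of_le hle]
  have hu' : tupleExp (Function.update v j w) + e = u := by
    have h1 := tupleExp_update v j w
    refine add_right_cancel (b := Finsupp.single (v j) 1 + Finsupp.single w 1) ?_
    calc _ = (tupleExp (Function.update v j w) + Finsupp.single (v j) 1) +
          (Finsupp.single w 1 + e) := by abel
      _ = _ := by rw [h1, he', ← hu]; abel
  obtain ⟨s', -, rfl⟩ := hsupp _ _ hw hu'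
  rw [hj] at he' hwj
  have hws := eq_of_single_add_diag hwj he'
  have hs' : tupleExp (diag s') = tupleExp (diag (Function.update s r a)) := by
    have h1 := tupleExp_update (diag s) r (toLex (r, a))
    rw [← diag_update] at h1
    have h2 : diag s r = w := hws.symm
    rw [h2, add_comm (tupleExp (diag s)), ← he', add_comm] at h1
    exact (add_left_cancel h1).symm
  rw [hs'] at hw hu'
  refine ⟨fun h => hwj ?_, _, hw, hu'⟩
  rw [hws, h]

/-- Where `s` and `t` differ in row `r`, the variable `(r, t r)` divides `u` but is off the diagonal
of `s`, hence occurs in `v`. Exchanging it in reduces the number of differing rows. -/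
theorem exists_of_transversal (hc : c ∈ koszulCycles P i)
    (hsupp : ∀ v e, coeff e (c v) ≠ 0 → tupleExp v + e = u →
      ∃ s, IsFaceTuple Δ s ∧ e = tupleExp (diag s))
    {t : Fin n → Fin m} (ht : ∀ r, u (toLex (r, t r)) ≠ 0)
    {v : Fin i → Fin n ×ₗ Fin m} {s : Fin n → Fin m} (hne : coeff (tupleExp (diag s)) (c v) ≠ 0)
    (hu : tupleExp v + tupleExp (diag s) = u) :
    ∃ v', coeff (tupleExp (diag t)) (c v') ≠ 0 ∧ tupleExp v' + tupleExp (diag t) = u := by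
  induction hN : (Finset.univ.filter fun r => s r ≠ t r).card using Nat.strong_induction_on
    generalizing v s with
  | h N ih =>
  by_cases hst : s = t
  · subst hst
    exact ⟨v, hne, hu⟩
  obtain ⟨r, hr⟩ := Function.ne_iff.1 hst
  have hv : tupleExp v (toLex (r, t r)) ≠ 0 := by
    have := ht r
    rwa [← hu, Finsupp.add_apply, tupleExp_diag_apply, if_neg hr, add_zero] at this
  obtain ⟨j, hj⟩ := tupleExp_ne_zero_iff.1 hv
  obtain ⟨-, v', hv', hu'⟩ := exchange hc hsupp hne hu hj
  refine ih _ ?_ hv' hu' rfl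
  rw [← hN]
  refine Finset.card_lt_card ⟨fun q hq => ?_, fun hsub => ?_⟩
  · rw [Finset.mem_filter] at hq ⊢
    refine ⟨hq.1, ?_⟩
    by_cases hqr : q = r
    · subst hqr; exact hr
    · simpa [Function.update_of_ne hqr] using hq.2
  · have := hsub (Finset.mem_filter.2 ⟨Finset.mem_univ r, hr⟩)
    simp at this

/-- The multidegree of a nonzero component of a cycle with diagonal monomials is a block set, and
its coefficient at the chosen transversal does not vanish. -/
theorem exists_blockSet (hn : 1 ≤ n)
    (hnonface : ∀ σ : Finset (Fin m), σ.card = n + 1 → ¬ IsINonface (cliqueComplex n Δ) 1 σ)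
    (hc : c ∈ koszulCycles P i)
    (hsupp : ∀ v e, coeff e (c v) ≠ 0 → tupleExp v + e = u →
      ∃ s, IsFaceTuple Δ s ∧ e = tupleExp (diag s))
    {v : Fin i → Fin n ×ₗ Fin m} {s : Fin n → Fin m} (hne : coeff (tupleExp (diag s)) (c v) ≠ 0)
    (hu : tupleExp v + tupleExp (diag s) = u) :
    ∃ (U : Finset (Fin n ×ₗ Fin m)) (hU : IsBlockSet Δ i U),
      coeff (tupleExp (diag hU.transversal)) (c hU.tuple) ≠ 0 := by
  have hvinj : Function.Injective v := fun a b hab => by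
    by_contra hne'
    exact hne (by rw [hc.2.1 v a b hne' hab, coeff_zero])
  have hdisj : Disjoint (Finset.univ.image v) (Finset.univ.image (diag s)) := by
    rw [Finset.disjoint_left]
    rintro x hx hx'
    obtain ⟨j, -, rfl⟩ := Finset.mem_image.1 hx
    obtain ⟨r, -, hr⟩ := Finset.mem_image.1 hx'
    exact (exchange hc hsupp hne hu (j := j) (r := r) (a := s r) hr.symm).1 rfl
  obtain ⟨U, hUdef⟩ : ∃ U, U = Finset.univ.image v ∪ Finset.univ.image (diag s) := ⟨_, rfl⟩
  have hUu : setExp U = u := by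
    rw [← hu, tupleExp_eq_setExp hvinj, tupleExp_eq_setExp (diag_injective s), hUdef]
    exact Finset.sum_union hdisj
  have hmem : ∀ x, x ∈ U → u x ≠ 0 := by
    intro x hx
    rw [← hUu, setExp_apply, if_pos hx]
    exact one_ne_zero
  have htr : ∀ t : Fin n → Fin m, (∀ r, toLex (r, t r) ∈ U) →
      ∃ v', coeff (tupleExp (diag t)) (c v') ≠ 0 ∧ tupleExp v' + tupleExp (diag t) = u :=
    fun t ht => exists_of_transversal hc hsupp (fun r => hmem _ (ht r)) hne hu
  have htr' : ∀ t : Fin n → Fin m, (∀ r, toLex (r, t r) ∈ U) → IsFaceTuple Δ t := by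
    intro t ht
    obtain ⟨v', h1, h2⟩ := htr t ht
    obtain ⟨s', hs', heq⟩ := hsupp _ _ h1 h2
    rwa [tupleExp_diag_injective heq]
  have hrow : ∀ r, ∃ a, toLex (r, a) ∈ U := fun r => ⟨s r, by
    rw [hUdef]
    exact Finset.mem_union_right _ (Finset.mem_image.2 ⟨r, Finset.mem_univ _, rfl⟩)⟩
  have hU : IsBlockSet Δ i U := by
    refine ⟨?_, hrow, ?_, face_of_transversals hn hnonface U hrow htr'⟩
    · rw [hUdef, Finset.card_union_of_disjoint hdisj, Finset.card_image_of_injective _ hvinj,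
        Finset.card_image_of_injective _ (diag_injective s)]
      simp [add_comm]
    · intro r q a b ha hb hrq
      obtain ⟨t, ht, rfl, rfl⟩ := exists_transversal_through hrow ha hb hrq.ne
      exact (htr' t ht).1 hrq
  refine ⟨U, hU, ?_⟩
  have hadd := hU.tupleExp_add
  have htU : ∀ r, toLex (r, hU.transversal r) ∈ U := by
    intro r
    by_contra hr
    have h1 := DFunLike.congr_fun hadd (toLex (r, hU.transversal r))
    rw [setExp_apply, if_neg hr, Finsupp.add_apply, tupleExp_diag_apply] at h1
    simp at h1
  obtain ⟨v', h1, h2⟩ := htr _ htU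
  -- The tuple complementary to the transversal is determined up to order, so its coefficient is
  -- determined up to sign.
  have h3 : tupleExp v' = tupleExp hU.tuple := by
    rw [← hUu, ← hadd] at h2
    exact add_right_cancel h2
  obtain ⟨π, rfl⟩ := exists_perm_of_tupleExp_eq hU.tuple_injective h3
  intro h0
  rcases koszulCycles_comp_perm hc hU.tuple π with h | h
  · exact h1 (by rw [h, h0])
  · exact h1 (by rw [h, coeff_neg, h0, neg_zero])

variable (P i Δ) in
/-- The coefficients of a cycle at the chosen transversals of the block sets. -/
noncomputable def blockCoeff :
    koszulCycles P i →ₗ[k] ({U : Finset (Fin n ×ₗ Fin m) // IsBlockSet Δ i U} → k) where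
  toFun c U := coeff (tupleExp (diag U.2.transversal)) (c.1 U.2.tuple)
  map_add' c c' := by
    funext U
    simp
  map_smul' r c := by
    funext U
    simp

/-- At the largest value of `tupleExp v` plus the leading exponent of `c v`, every contributing
monomial is a leading one and hence diagonal. So `exists_blockSet` yields a nonvanishing block
coefficient. -/
theorem blockCoeff_injective (hn : 1 ≤ n)
    (hnonface : ∀ σ : Finset (Fin m), σ.card = n + 1 → ¬ IsINonface (cliqueComplex n Δ) 1 σ)
    (hP : ∀ p ∈ P, p ≠ 0 → ∃ s : Fin n → Fin m, IsFaceTuple Δ s ∧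
      MonomialOrder.lex.degree p = tupleExp (diag s)) :
    Function.Injective (blockCoeff i Δ P) := by
  classical
  rw [injective_iff_map_eq_zero]
  rintro ⟨c, hc⟩ h0
  by_contra hne
  have hne : c ≠ 0 := fun h => hne (Subtype.ext h)
  obtain ⟨v₀, hv₀⟩ := Function.ne_iff.1 hne
  obtain ⟨v, hv, hmax⟩ := Finset.exists_max_image
    (Finset.univ.filter fun v => c v ≠ 0)
    (fun v => MonomialOrder.lex.toSyn (tupleExp v + MonomialOrder.lex.degree (c v)))
    ⟨v₀, Finset.mem_filter.2 ⟨Finset.mem_univ _, hv₀⟩⟩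
  have hcv : c v ≠ 0 := (Finset.mem_filter.1 hv).2
  obtain ⟨s, -, hs⟩ := hP _ (hc.1 v) hcv
  have hne' : coeff (tupleExp (diag s)) (c v) ≠ 0 := by
    rw [← hs]
    exact MonomialOrder.lex.coeff_degree_ne_zero_iff.2 hcv
  have hsupp : ∀ v' e, coeff e (c v') ≠ 0 → tupleExp v' + e = tupleExp v + tupleExp (diag s) →
      ∃ s, IsFaceTuple Δ s ∧ e = tupleExp (diag s) := by
    intro v' e he hsum
    have hcv' : c v' ≠ 0 := fun h => he (by rw [h, coeff_zero])
    have h1 := hmax v' (Finset.mem_filter.2 ⟨Finset.mem_univ _, hcv'⟩)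
    have h2 := MonomialOrder.lex.le_degree (mem_support_iff.2 he)
    simp only [hs] at h1
    rw [← hsum, map_add, map_add, add_le_add_iff_left] at h1
    obtain ⟨s', hs', hd⟩ := hP _ (hc.1 v') hcv'
    refine ⟨s', hs', ?_⟩
    rw [← hd]
    exact MonomialOrder.lex.toSyn.injective (le_antisymm h2 h1)
  obtain ⟨U, hU, hUne⟩ := exists_blockSet hn hnonface hc hsupp hne' rfl
  exact hUne (congrFun h0 ⟨U, hU⟩)

end UpperBound

/-! ### Minors -/

section Minors

variable (k : Type*) [Field k] {n m : ℕ}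

/-- The maximal minor of the generic matrix on the columns `t_1, …, t_n`, in this order. -/
noncomputable def minorOf (t : Fin n → Fin m) : PolyRing k n m :=
  ((genericMatrix k n m).submatrix id t).det

variable {k}

theorem prod_X_diag (t : Fin n → Fin m) :
    ∏ q, (X (toLex (q, t q)) : PolyRing k n m) = monomial (tupleExp (diag t)) 1 := by
  rw [tupleExp, monomial_sum_one]
  rfl

theorem minorOf_eq_sum (t : Fin n → Fin m) :
    minorOf k t = ∑ π : Equiv.Perm (Fin n),
      Equiv.Perm.sign π • monomial (tupleExp (diag (t ∘ π))) (1 : k) := by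
  rw [minorOf, ← Matrix.det_transpose, Matrix.det_apply]
  refine Finset.sum_congr rfl fun π _ => ?_
  rw [← prod_X_diag]
  rfl

theorem exists_perm_of_coeff_minorOf {t : Fin n → Fin m} {e : (Fin n ×ₗ Fin m) →₀ ℕ}
    (h : coeff e (minorOf k t) ≠ 0) :
    ∃ π : Equiv.Perm (Fin n), e = tupleExp (diag (t ∘ π)) := by
  rw [minorOf_eq_sum, coeff_sum] at h
  obtain ⟨π, -, hπ⟩ := Finset.exists_ne_zero_of_sum_ne_zero h
  refine ⟨π, ?_⟩
  by_contra hne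
  rw [Units.smul_def, coeff_smul, coeff_monomial, if_neg (Ne.symm hne), smul_zero] at hπ
  exact hπ rfl

theorem coeff_minorOf_diag {t : Fin n → Fin m} (ht : Function.Injective t) :
    coeff (tupleExp (diag t)) (minorOf k t) = 1 := by
  rw [minorOf_eq_sum, coeff_sum, Finset.sum_eq_single 1]
  · simp
  · intro π _ hπ
    rw [Units.smul_def, coeff_smul, coeff_monomial, if_neg, smul_zero]
    intro h
    refine hπ (Equiv.ext fun q => ht ?_)
    exact congrFun (tupleExp_diag_injective h) q
  · simp

theorem degree_tupleExp {ι : Type*} {i : ℕ} (v : Fin i → ι) : (tupleExp v).degree = i := by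
  simp [tupleExp]

theorem isHomogeneous_minorOf (t : Fin n → Fin m) : (minorOf k t).IsHomogeneous n := by
  intro e he
  obtain ⟨π, rfl⟩ := exists_perm_of_coeff_minorOf he
  change Finsupp.weight (fun _ => 1) _ = n
  rw [← Finsupp.degree_eq_weight_one, degree_tupleExp]

/-- Reordering the columns changes a minor at most by a sign. -/
theorem minorOf_comp_perm (t : Fin n → Fin m) (π : Equiv.Perm (Fin n)) :
    minorOf k (t ∘ π) = ((Equiv.Perm.sign π : ℤ) : PolyRing k n m) * minorOf k t :=
  Matrix.det_permute' π ((genericMatrix k n m).submatrix id t)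

theorem isFacet_of_card {Δ : PreAbstractSimplicialComplex (Fin m)} (hpure : IsPureCard n Δ)
    {σ : Finset (Fin m)} (hσ : σ ∈ Δ) (hcard : σ.card = n) : IsFacet Δ σ := by
  obtain ⟨τ, hle, hτ⟩ := Set.Finite.exists_le_maximal (Set.toFinite {τ | τ ∈ Δ}) hσ
  have := hpure τ hτ
  rwa [Finset.eq_of_subset_of_card_le hle (by omega)]

theorem minorOf_mem_facetIdeal {Δ : PreAbstractSimplicialComplex (Fin m)}
    (hpure : IsPureCard n Δ) {t : Fin n → Fin m} (ht : Function.Injective t)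
    (hΔ : Finset.univ.image t ∈ Δ) : minorOf k t ∈ facetIdeal k n Δ := by
  have hcard : (Finset.univ.image t).card = n := by
    rw [Finset.card_image_of_injective _ ht]; simp
  have h1 : ∀ r, ∃ q, (Finset.univ.image t).orderEmbOfFin hcard q = t r := fun r => by
    have : t r ∈ Set.range ((Finset.univ.image t).orderEmbOfFin hcard) := by
      rw [Finset.range_orderEmbOfFin]
      simp
    exact this
  choose f hf using h1
  have hinj : Function.Injective f := fun a b hab => ht (by rw [← hf, ← hf, hab])
  have heq : t = (Finset.univ.image t).orderEmbOfFin hcard ∘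
      Equiv.ofBijective f (Finite.injective_iff_bijective.1 hinj) :=
    funext fun r => (hf r).symm
  have hmem : minorOf k ((Finset.univ.image t).orderEmbOfFin hcard) ∈ facetIdeal k n Δ :=
    Ideal.subset_span ⟨_, isFacet_of_card hpure hΔ hcard, hcard, rfl⟩
  rw [heq, minorOf_comp_perm]
  exact Ideal.mul_mem_left _ _ hmem

end Minors

/-! ### Lexicographic comparison -/

section Lex

variable {n m i : ℕ}

theorem sum_tupleExp_column (v : Fin i → Fin n ×ₗ Fin m) (a : Fin m) :
    ∑ r, tupleExp v (toLex (r, a)) = ∑ j, if (ofLex (v j)).2 = a then 1 else 0 := by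
  simp only [tupleExp, Finsupp.finsetSum_apply]
  rw [Finset.sum_comm]
  refine Finset.sum_congr rfl fun j _ => ?_
  obtain ⟨q, b, hq⟩ : ∃ q b, v j = toLex (q, b) := ⟨(ofLex (v j)).1, (ofLex (v j)).2, rfl⟩
  rw [Finset.sum_eq_single q]
  · rw [hq, Finsupp.single_apply]
    by_cases h : b = a <;> simp [h]
  · intro r _ hr
    rw [Finsupp.single_apply, if_neg]
    rw [hq]
    exact fun h => hr (congrArg (fun x => (ofLex x).1) h).symm
  · simp

theorem sum_tupleExp_row (v : Fin i → Fin n ×ₗ Fin m) (r : Fin n) :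
    ∑ a, tupleExp v (toLex (r, a)) = ∑ j, if (ofLex (v j)).1 = r then 1 else 0 := by
  simp only [tupleExp, Finsupp.finsetSum_apply]
  rw [Finset.sum_comm]
  refine Finset.sum_congr rfl fun j _ => ?_
  obtain ⟨q, b, hq⟩ : ∃ q b, v j = toLex (q, b) := ⟨(ofLex (v j)).1, (ofLex (v j)).2, rfl⟩
  rw [Finset.sum_eq_single b]
  · rw [hq, Finsupp.single_apply]
    by_cases h : q = r <;> simp [h]
  · intro a _ ha
    rw [Finsupp.single_apply, if_neg]
    rw [hq]
    exact fun h => ha (congrArg (fun x => (ofLex x).2) h).symm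
  · simp

/-- Among the exponents with given row and column sums, the one that fills the rows from left to
right is the largest. -/
theorem lex_le_setExp {U : Finset (Fin n ×ₗ Fin m)}
    (hU : ∀ {r q : Fin n} {a b : Fin m}, toLex (r, a) ∈ U → toLex (q, b) ∈ U → r < q → a < b)
    {f : (Fin n ×ₗ Fin m) →₀ ℕ}
    (hrow : ∀ r, ∑ a, f (toLex (r, a)) = ∑ a, setExp U (toLex (r, a)))
    (hcol : ∀ a, ∑ r, f (toLex (r, a)) = ∑ r, setExp U (toLex (r, a))) :
    MonomialOrder.lex.toSyn f ≤ MonomialOrder.lex.toSyn (setExp U) := by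
  by_contra! hlt
  rw [MonomialOrder.lex_lt_iff, Finsupp.Lex.lt_iff] at hlt
  obtain ⟨x, heq, hx⟩ := hlt
  simp only [ofLex_toLex] at heq hx
  obtain ⟨r, a, rfl⟩ : ∃ r a, x = toLex (r, a) := ⟨(ofLex x).1, (ofLex x).2, rfl⟩
  -- At the first difference `f` is larger, so the sum of column `a` forces a deficit at some `(q,
  -- a)`. That position is in `U`, and `q > r` because all earlier positions agree.
  obtain ⟨q, hq⟩ : ∃ q, f (toLex (q, a)) < setExp U (toLex (q, a)) := by
    by_contra! hall
    exact (Finset.sum_lt_sum (fun q _ => hall q) ⟨r, Finset.mem_univ r, hx⟩).ne' (hcol a)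
  have hqU : toLex (q, a) ∈ U := by
    by_contra hn
    rw [setExp_apply, if_neg hn] at hq
    omega
  have hrq : r < q := by
    rcases lt_trichotomy q r with h | rfl | h
    · exact absurd (heq (toLex (q, a)) (Prod.Lex.toLex_lt_toLex.2 (Or.inl h))) hq.ne'
    · omega
    · exact h
  -- As `(q, a) ∈ U` with `q > r`, row `r` of `U` has nothing to the right of `a`; so the sum of row
  -- `r` of `f` is too large.
  refine (Finset.sum_lt_sum (s := Finset.univ) (f := fun b => setExp U (toLex (r, b)))
    (g := fun b => f (toLex (r, b))) (fun b _ => ?_) ⟨a, Finset.mem_univ a, hx⟩).ne' (hrow r)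
  rcases lt_trichotomy b a with h | rfl | h
  · exact (heq (toLex (r, b)) (Prod.Lex.toLex_lt_toLex.2 (Or.inr ⟨rfl, h⟩))).le
  · exact hx.le
  · rw [setExp_apply, if_neg]
    · exact Nat.zero_le _
    · exact fun hb => absurd (hU hb hqU hrq) h.not_gt

theorem lex_diag_comp_perm_le {s : Fin n → Fin m} (hs : StrictMono s)
    (π : Equiv.Perm (Fin n)) :
    MonomialOrder.lex.toSyn (tupleExp (diag (s ∘ π))) ≤
      MonomialOrder.lex.toSyn (tupleExp (diag s)) := by
  have hset := tupleExp_eq_setExp (diag_injective s)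
  rw [hset]
  refine lex_le_setExp ?_ (fun r => ?_) (fun a => ?_)
  · intro r q a b hr hq hrq
    obtain ⟨r', -, hr'⟩ := Finset.mem_image.1 hr
    obtain ⟨q', -, hq'⟩ := Finset.mem_image.1 hq
    cases hr'
    cases hq'
    exact hs hrq
  · rw [← hset, sum_tupleExp_row, sum_tupleExp_row]
    rfl
  · rw [← hset, sum_tupleExp_column, sum_tupleExp_column]
    exact Equiv.sum_comp π fun q => if s q = a then 1 else 0

end Lex

/-! ### The facet ideal and its initial ideal in degree `n` -/

section LowDegree

variable {k : Type*} [Field k] {n m : ℕ} {Δ : PreAbstractSimplicialComplex (Fin m)}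

/-- The generators have degree `n`, so multipliers act on the degree `n` part through their constant
terms only. -/
theorem facetIdeal_low_degree {p : PolyRing k n m} (hp : p ∈ facetIdeal k n Δ) :
    OrderGE n p ∧ ∃ g : (Fin n → Fin m) → k, (∀ s, g s ≠ 0 → IsFaceTuple Δ s) ∧
      ∀ e, e.degree = n → coeff e p = ∑ s, g s * coeff e (minorOf k s) := by
  classical
  induction hp using Submodule.span_induction with
  | mem p hp =>
    obtain ⟨σ, hσ, hcard, rfl⟩ := hp
    refine ⟨fun e he => (isHomogeneous_minorOf (k := k) _).coeff_eq_zero he.ne,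
      Pi.single (σ.orderEmbOfFin hcard) 1, fun s hs => ?_, fun e _ => ?_⟩
    · have : s = σ.orderEmbOfFin hcard := by
        by_contra hne
        rw [Pi.single_eq_of_ne hne] at hs
        exact hs rfl
      subst this
      refine ⟨(σ.orderEmbOfFin hcard).strictMono, ?_⟩
      rw [Finset.image_orderEmbOfFin_univ]
      exact hσ.1
    · rw [Finset.sum_eq_single ⇑(σ.orderEmbOfFin hcard)]
      · rw [Pi.single_eq_same, one_mul]
        rfl
      · intro s _ hs
        rw [Pi.single_eq_of_ne hs, zero_mul]
      · simp
  | zero => exact ⟨fun e _ => coeff_zero e, 0, by simp, by simp⟩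
  | add p q _ _ hp hq =>
    obtain ⟨hp, g, hg, hpg⟩ := hp
    obtain ⟨hq, g', hg', hqg⟩ := hq
    refine ⟨fun e he => by rw [coeff_add, hp e he, hq e he, add_zero], g + g', fun s hs => ?_,
      fun e he => ?_⟩
    · by_cases h : g s = 0
      · exact hg' s fun h' => hs (by rw [Pi.add_apply, h, h', add_zero])
      · exact hg s h
    · rw [coeff_add, hpg e he, hqg e he, ← Finset.sum_add_distrib]
      exact Finset.sum_congr rfl fun s _ => by rw [Pi.add_apply, add_mul]
  | smul q p _ hp =>
    obtain ⟨hp, g, hg, hpg⟩ := hp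
    refine ⟨hp.mul_left q, fun s => constantCoeff q * g s,
      fun s hs => hg s (right_ne_zero_of_mul hs), fun e he => ?_⟩
    rw [smul_eq_mul, hp.coeff_mul_of_degree_le q he.le, hpg e he, Finset.mul_sum]
    exact Finset.sum_congr rfl fun s _ => by rw [mul_assoc]

/-- The largest exponent of degree `n` of an element of the facet ideal is a diagonal one. -/
theorem exists_faceTuple_of_max {p : PolyRing k n m} (hp : p ∈ facetIdeal k n Δ)
    {e : (Fin n ×ₗ Fin m) →₀ ℕ} (hdeg : e.degree = n) (he : coeff e p ≠ 0)
    (hmax : ∀ e', coeff e' p ≠ 0 → MonomialOrder.lex.toSyn e' ≤ MonomialOrder.lex.toSyn e) :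
    ∃ s : Fin n → Fin m, IsFaceTuple Δ s ∧ e = tupleExp (diag s) := by
  obtain ⟨-, g, hg, hpg⟩ := facetIdeal_low_degree hp
  have he' := he
  rw [hpg e hdeg] at he'
  obtain ⟨s, -, hs⟩ := Finset.exists_ne_zero_of_sum_ne_zero he'
  have hgs : g s ≠ 0 := left_ne_zero_of_mul hs
  obtain ⟨π, hπ⟩ := exists_perm_of_coeff_minorOf (right_ne_zero_of_mul hs)
  have hmono := (hg s hgs).1
  refine ⟨s, hg s hgs, MonomialOrder.lex.toSyn.injective (le_antisymm ?_ (hmax _ ?_))⟩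
  · rw [hπ]
    exact lex_diag_comp_perm_le hmono π
  -- Minors on different increasing tuples share no monomial, so this coefficient is exactly `g s`
  -- and cannot cancel.
  · rw [hpg _ (degree_tupleExp _), Finset.sum_eq_single s, coeff_minorOf_diag hmono.injective,
      mul_one]
    · exact hgs
    · intro s' _ hne
      by_contra h
      obtain ⟨π', hπ'⟩ := exists_perm_of_coeff_minorOf (right_ne_zero_of_mul h)
      have hss : s = s' ∘ π' := tupleExp_diag_injective hπ'
      refine hne ((StrictMono.range_inj (hg s' (left_ne_zero_of_mul h)).1 hmono).1 ?_)
      rw [hss, EquivLike.range_comp]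
    · simp

theorem degree_of_mem_facetIdeal {p : PolyRing k n m}
    (hp : p ∈ MinimalGradedFreeResolution.degreePart (facetIdeal k n Δ) n) (hne : p ≠ 0) :
    ∃ s : Fin n → Fin m, IsFaceTuple Δ s ∧
      MonomialOrder.lex.degree p = tupleExp (diag s) := by
  have hcoeff := MonomialOrder.lex.coeff_degree_ne_zero_iff.2 hne
  refine exists_faceTuple_of_max hp.1 ?_ hcoeff
    fun e he => MonomialOrder.lex.le_degree (mem_support_iff.2 he)
  by_contra hdeg
  have hh : p.IsHomogeneous n := hp.2
  exact hcoeff (hh.coeff_eq_zero hdeg)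

/-- The elements of `J_Δ` whose leading terms generate need not be homogeneous;
`exists_faceTuple_of_max` only asks that the leading exponent have degree `n`. -/
theorem initialIdeal_low_degree {p : PolyRing k n m}
    (hp : p ∈ initialIdeal (facetIdeal k n Δ)) :
    OrderGE n p ∧ ∀ e, e.degree = n → coeff e p ≠ 0 →
      ∃ s : Fin n → Fin m, IsFaceTuple Δ s ∧ e = tupleExp (diag s) := by
  classical
  induction hp using Submodule.span_induction with
  | mem p hp =>
    obtain ⟨f, hf, rfl⟩ := hp
    have hcoeff : ∀ e, coeff e (MonomialOrder.lex.leadingTerm f) ≠ 0 →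
        e = MonomialOrder.lex.degree f ∧ coeff e f ≠ 0 := by
      intro e he
      rw [MonomialOrder.leadingTerm, coeff_monomial] at he
      split_ifs at he with h
      · subst h
        exact ⟨rfl, he⟩
      · exact absurd rfl he
    refine ⟨fun e he => ?_, fun e hdeg he => ?_⟩
    · by_contra hne
      exact (hcoeff e hne).2 ((facetIdeal_low_degree hf).1 e he)
    · obtain ⟨rfl, hne⟩ := hcoeff e he
      exact exists_faceTuple_of_max hf hdeg hne
        fun e he => MonomialOrder.lex.le_degree (mem_support_iff.2 he)
  | zero => exact ⟨fun e _ => coeff_zero e, fun e _ h => absurd (coeff_zero e) h⟩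
  | add p q _ _ hp hq =>
    refine ⟨fun e he => by rw [coeff_add, hp.1 e he, hq.1 e he, add_zero], fun e he hne => ?_⟩
    by_cases h : coeff e p = 0
    · exact hq.2 e he fun h' => hne (by rw [coeff_add, h, h', add_zero])
    · exact hp.2 e he h
  | smul q p _ hp =>
    refine ⟨hp.1.mul_left q, fun e he hne => hp.2 e he ?_⟩
    rw [smul_eq_mul, hp.1.coeff_mul_of_degree_le q he.le] at hne
    exact right_ne_zero_of_mul hne

theorem degree_of_mem_initialIdeal {p : PolyRing k n m}
    (hp : p ∈ MinimalGradedFreeResolution.degreePart (initialIdeal (facetIdeal k n Δ)) n)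
    (hne : p ≠ 0) : ∃ s : Fin n → Fin m, IsFaceTuple Δ s ∧
      MonomialOrder.lex.degree p = tupleExp (diag s) := by
  have hcoeff := MonomialOrder.lex.coeff_degree_ne_zero_iff.2 hne
  refine (initialIdeal_low_degree hp.1).2 _ ?_ hcoeff
  by_contra hdeg
  have hh : p.IsHomogeneous n := hp.2
  exact hcoeff (hh.coeff_eq_zero hdeg)

end LowDegree

/-! ### Cycles from the Eagon–Northcott complex -/

section EagonNorthcott

variable {k : Type*} [Field k] {n m i : ℕ}

variable (k) in
/-- The matrix whose first rows are the unit vectors of the columns of `v`, and whose last rows are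
the rows of the generic matrix, restricted to the columns `e`. -/
noncomputable def enMatrix (e : Fin i ⊕ Fin n → Fin m) (v : Fin i → Fin n ×ₗ Fin m) :
    Matrix (Fin i ⊕ Fin n) (Fin i ⊕ Fin n) (PolyRing k n m) :=
  Matrix.of fun y x => Sum.elim (fun j => if e x = (ofLex (v j)).2 then 1 else 0)
    (fun q => X (toLex (q, e x))) y

/-- A term of the Leibniz expansion survives only if each unit-vector row is matched with its own
column. -/
theorem exists_perm_of_coeff_det_enMatrix {e : Fin i ⊕ Fin n → Fin m}
    {v : Fin i → Fin n ×ₗ Fin m} {μ : (Fin n ×ₗ Fin m) →₀ ℕ}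
    (h : coeff μ (enMatrix k e v).det ≠ 0) :
    ∃ π : Equiv.Perm (Fin i ⊕ Fin n), (∀ j, e (π (Sum.inl j)) = (ofLex (v j)).2) ∧
      μ = tupleExp (diag fun q => e (π (Sum.inr q))) := by
  rw [← Matrix.det_transpose, Matrix.det_apply, coeff_sum] at h
  obtain ⟨π, -, hπ⟩ := Finset.exists_ne_zero_of_sum_ne_zero h
  rw [Units.smul_def, coeff_smul, Fintype.prod_sum_type] at hπ
  have hπ := right_ne_zero_of_smul hπ
  simp only [Matrix.transpose_apply, enMatrix, Matrix.of_apply, Sum.elim_inl, Sum.elim_inr]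
    at hπ
  rw [prod_X_diag fun q => e (π (Sum.inr q))] at hπ
  have hcol : ∀ j, e (π (Sum.inl j)) = (ofLex (v j)).2 := by
    intro j
    by_contra hne
    rw [Finset.prod_eq_zero (Finset.mem_univ j) (if_neg hne), zero_mul, coeff_zero] at hπ
    exact hπ rfl
  refine ⟨π, hcol, ?_⟩
  by_contra hne
  rw [Finset.prod_eq_one fun j _ => if_pos (hcol j), one_mul, coeff_monomial,
    if_neg (Ne.symm hne)] at hπ
  exact hπ rfl

/-- Moving the columns of `v` to the front makes the matrix block triangular with an identity block,
leaving the minor on the remaining columns. -/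
theorem det_enMatrix_of_perm {e : Fin i ⊕ Fin n → Fin m} (he : Function.Injective e)
    {v : Fin i → Fin n ×ₗ Fin m} (π : Equiv.Perm (Fin i ⊕ Fin n))
    (hπ : ∀ j, e (π (Sum.inl j)) = (ofLex (v j)).2) :
    ((Equiv.Perm.sign π : ℤ) : PolyRing k n m) * (enMatrix k e v).det =
      minorOf k fun q => e (π (Sum.inr q)) := by
  rw [← Matrix.det_permute']
  have hinj : Function.Injective fun x => e (π x) := he.comp π.injective
  have : (enMatrix k e v).submatrix id π = Matrix.fromBlocks 1 0
      (Matrix.of fun q j => X (toLex (q, e (π (Sum.inl j)))))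
      ((genericMatrix k n m).submatrix id fun q => e (π (Sum.inr q))) := by
    ext1 y x
    rcases y with j | q <;> rcases x with j' | q'
    · simp only [Matrix.submatrix_apply, id, enMatrix, Matrix.of_apply, Sum.elim_inl,
        Matrix.fromBlocks_apply₁₁, Matrix.one_apply, ← hπ j]
      refine if_congr ⟨fun h => ?_, fun h => by rw [h]⟩ rfl rfl
      exact (Sum.inl_injective (hinj h)).symm
    · simp only [Matrix.submatrix_apply, id, enMatrix, Matrix.of_apply, Sum.elim_inl,
        Matrix.fromBlocks_apply₁₂, Matrix.zero_apply, ← hπ j]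
      exact if_neg fun h => Sum.inr_ne_inl (hinj h)
    · rfl
    · rfl
  rw [this, Matrix.det_fromBlocks_zero₁₂, Matrix.det_one, one_mul]
  rfl

/-- How many of the rows `ρ_1, …, ρ_i` are equal to a given one. -/
def rowCount (ρ : Fin i → Fin n) : Fin n → ℕ := fun r => ∑ j, if ρ j = r then 1 else 0

variable (k) in
open Classical in
/-- The Koszul cycle given by the Eagon–Northcott complex on the columns `e` and the row
multiplicities `α`. -/
noncomputable def enCycle (e : Fin i ⊕ Fin n → Fin m) (α : Fin n → ℕ)
    (v : Fin i → Fin n ×ₗ Fin m) : PolyRing k n m :=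
  if rowCount (fun j => (ofLex (v j)).1) = α then (enMatrix k e v).det else 0

theorem enCycle_eq_zero_of_eq {e : Fin i ⊕ Fin n → Fin m} {α : Fin n → ℕ}
    {v : Fin i → Fin n ×ₗ Fin m} {a b : Fin i} (hab : a ≠ b) (hv : v a = v b) :
    enCycle k e α v = 0 := by
  rw [enCycle]
  split_ifs
  · refine Matrix.det_zero_of_row_eq (i := Sum.inl a) (j := Sum.inl b)
      (fun h => hab (Sum.inl_injective h)) ?_
    funext x
    simp only [enMatrix, Matrix.of_apply, Sum.elim_inl, hv]
  · rfl

theorem enCycle_comp_swap {e : Fin i ⊕ Fin n → Fin m} {α : Fin n → ℕ}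
    (v : Fin i → Fin n ×ₗ Fin m) {a b : Fin i} (hab : a ≠ b) :
    enCycle k e α (v ∘ Equiv.swap a b) = - enCycle k e α v := by
  have hrow : rowCount (fun j => (ofLex ((v ∘ Equiv.swap a b) j)).1) =
      rowCount fun j => (ofLex (v j)).1 :=
    funext fun r => Equiv.sum_comp (Equiv.swap a b) fun j => if (ofLex (v j)).1 = r then 1 else 0
  have hmat : enMatrix k e (v ∘ Equiv.swap a b) =
      (enMatrix k e v).submatrix (Equiv.Perm.sumCongr (Equiv.swap a b) 1) id := by
    ext1 y x
    rcases y with j | q <;> rfl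
  rw [enCycle, enCycle, hrow, hmat, Matrix.det_permute, Equiv.Perm.sign_sumCongr,
    Equiv.Perm.sign_swap hab]
  split_ifs <;> simp

/-- For fixed `r`, summing `x_{ra}` times the unit row of `a` replaces row `j` by row `r` of the
generic matrix, which already occurs below; the determinant then has a repeated row. The row count
depends on `r` but not on `a`, so the case distinction is constant in the inner sum. -/
theorem sum_X_mul_enCycle (e : Fin i ⊕ Fin n → Fin m) (α : Fin n → ℕ)
    (v : Fin i → Fin n ×ₗ Fin m) (j : Fin i) :
    ∑ w, X w * enCycle k e α (Function.update v j w) = 0 := by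
  rw [← Equiv.sum_comp (toLex : Fin n × Fin m ≃ Fin n ×ₗ Fin m), Fintype.sum_prod_type]
  refine Finset.sum_eq_zero fun r _ => ?_
  have hrow : ∀ a, (fun l => (ofLex (Function.update v j (toLex (r, a)) l)).1) =
      Function.update (fun l => (ofLex (v l)).1) j r := by
    intro a
    funext l
    by_cases hl : l = j
    · subst hl; simp
    · simp [hl]
  simp only [enCycle, hrow]
  split_ifs
  swap
  · simp
  have hmat : ∀ a, (enMatrix k e (Function.update v j (toLex (r, a)))).det =
      Matrix.cramer (enMatrix k e v).transpose (fun x => if e x = a then 1 else 0)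
        (Sum.inl j) := by
    intro a
    rw [Matrix.cramer_transpose_apply]
    congr 1
    ext1 y x
    rcases y with l | q
    · by_cases hl : l = j
      · subst hl
        simp [enMatrix]
      · rw [Matrix.updateRow_ne fun h => hl (Sum.inl_injective h)]
        simp [enMatrix, hl]
    · rw [Matrix.updateRow_ne Sum.inr_ne_inl]
      rfl
  have hsum : ∑ a, (X (toLex (r, a)) : PolyRing k n m) •
      (fun x => if e x = a then (1 : PolyRing k n m) else 0) = enMatrix k e v (Sum.inr r) := by
    funext x
    simp [enMatrix, Finset.sum_apply]
  have hlin := congrFun (map_sum (Matrix.cramer (enMatrix k e v).transpose)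
    (fun a => (X (toLex (r, a)) : PolyRing k n m) •
      (fun x => if e x = a then (1 : PolyRing k n m) else 0)) Finset.univ) (Sum.inl j)
  rw [hsum, Finset.sum_apply] at hlin
  simp only [map_smul, Pi.smul_apply, smul_eq_mul, ← hmat] at hlin
  rw [← hlin, Matrix.cramer_transpose_apply]
  refine Matrix.det_zero_of_row_eq (i := Sum.inl j) (j := Sum.inr r) Sum.inl_ne_inr ?_
  rw [Matrix.updateRow_self, Matrix.updateRow_ne Sum.inr_ne_inl]

end EagonNorthcott

/-! ### The lower bound -/

section LowerBound

variable {k : Type*} [Field k] {n m i : ℕ} {Δ : PreAbstractSimplicialComplex (Fin m)}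

/-- The columns of the chosen tuple and transversal of a block set. -/
noncomputable def IsBlockSet.cols {U : Finset (Fin n ×ₗ Fin m)} (hU : IsBlockSet Δ i U) :
    Fin i ⊕ Fin n → Fin m :=
  Sum.elim (fun j => (ofLex (hU.tuple j)).2) hU.transversal

theorem IsBlockSet.tuple_mem {U : Finset (Fin n ×ₗ Fin m)} (hU : IsBlockSet Δ i U) (j : Fin i) :
    hU.tuple j ∈ U := by
  by_contra hj
  have h1 := DFunLike.congr_fun hU.tupleExp_add (hU.tuple j)
  rw [setExp_apply, if_neg hj, Finsupp.add_apply] at h1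
  exact tupleExp_ne_zero_iff.2 ⟨j, rfl⟩ (Nat.eq_zero_of_add_eq_zero_right h1)

theorem IsBlockSet.diag_mem {U : Finset (Fin n ×ₗ Fin m)} (hU : IsBlockSet Δ i U) (r : Fin n) :
    diag hU.transversal r ∈ U := by
  by_contra hr
  have h1 := DFunLike.congr_fun hU.tupleExp_add (diag hU.transversal r)
  rw [setExp_apply, if_neg hr, Finsupp.add_apply] at h1
  exact tupleExp_ne_zero_iff.2 ⟨r, rfl⟩ (Nat.eq_zero_of_add_eq_zero_left h1)

theorem IsBlockSet.tuple_ne_diag {U : Finset (Fin n ×ₗ Fin m)} (hU : IsBlockSet Δ i U)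
    (j : Fin i) (r : Fin n) : hU.tuple j ≠ diag hU.transversal r := by
  intro h
  have h1 := DFunLike.congr_fun hU.tupleExp_add (hU.tuple j)
  rw [setExp_apply, if_pos (hU.tuple_mem j), Finsupp.add_apply] at h1
  have h2 := (tupleExp_ne_zero_iff (v := hU.tuple) (x := hU.tuple j)).2 ⟨j, rfl⟩
  have h3 := (tupleExp_ne_zero_iff (v := diag hU.transversal) (x := hU.tuple j)).2 ⟨r, h.symm⟩
  omega

theorem IsBlockSet.eq_of_column_eq {U : Finset (Fin n ×ₗ Fin m)} (hU : IsBlockSet Δ i U)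
    {x y : Fin n ×ₗ Fin m} (hx : x ∈ U) (hy : y ∈ U) (h : (ofLex x).2 = (ofLex y).2) :
    x = y := by
  obtain ⟨r, a, rfl⟩ : ∃ r a, x = toLex (r, a) := ⟨(ofLex x).1, (ofLex x).2, rfl⟩
  obtain ⟨q, b, rfl⟩ : ∃ q b, y = toLex (q, b) := ⟨(ofLex y).1, (ofLex y).2, rfl⟩
  have h : a = b := h
  subst h
  rcases lt_trichotomy r q with h | rfl | h
  · exact absurd (hU.lt_of_lt hx hy h) (lt_irrefl _)
  · rfl
  · exact absurd (hU.lt_of_lt hy hx h) (lt_irrefl _)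

theorem IsBlockSet.cols_injective {U : Finset (Fin n ×ₗ Fin m)} (hU : IsBlockSet Δ i U) :
    Function.Injective hU.cols := by
  rintro (j | r) (l | q) h
  · exact congrArg _ (hU.tuple_injective (hU.eq_of_column_eq (hU.tuple_mem j) (hU.tuple_mem l) h))
  · exact absurd (hU.eq_of_column_eq (hU.tuple_mem j) (hU.diag_mem q) h) (hU.tuple_ne_diag j q)
  · exact absurd (hU.eq_of_column_eq (hU.tuple_mem l) (hU.diag_mem r) h.symm)
      (hU.tuple_ne_diag l r)
  · exact congrArg _ (diag_injective _ (hU.eq_of_column_eq (hU.diag_mem r) (hU.diag_mem q) h))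

theorem IsBlockSet.cols_mem {U : Finset (Fin n ×ₗ Fin m)} (hU : IsBlockSet Δ i U)
    (x : Fin i ⊕ Fin n) : hU.cols x ∈ columns U := by
  rcases x with j | r
  · exact mem_columns.2 ⟨_, hU.tuple_mem j⟩
  · exact mem_columns.2 ⟨r, hU.diag_mem r⟩

variable (k) in
/-- The cycle of a block set. -/
noncomputable def IsBlockSet.cycle {U : Finset (Fin n ×ₗ Fin m)} (hU : IsBlockSet Δ i U) :
    (Fin i → Fin n ×ₗ Fin m) → PolyRing k n m :=
  enCycle k hU.cols (rowCount fun j => (ofLex (hU.tuple j)).1)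

theorem IsBlockSet.cycle_apply_mem {U : Finset (Fin n ×ₗ Fin m)} (hU : IsBlockSet Δ i U)
    (hpure : IsPureCard n Δ) (v : Fin i → Fin n ×ₗ Fin m) :
    hU.cycle k v ∈ MinimalGradedFreeResolution.degreePart (facetIdeal k n Δ) n := by
  rw [IsBlockSet.cycle, enCycle]
  split_ifs
  swap
  · exact Submodule.zero_mem _
  by_cases hdet : (enMatrix k hU.cols v).det = 0
  · rw [hdet]
    exact Submodule.zero_mem _
  obtain ⟨μ, hμ⟩ := MvPolynomial.ne_zero_iff.1 hdet
  obtain ⟨π, hπ, -⟩ := exists_perm_of_coeff_det_enMatrix hμ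
  have hminor := det_enMatrix_of_perm (k := k) hU.cols_injective π hπ
  have ht : Function.Injective fun q => hU.cols (π (Sum.inr q)) :=
    hU.cols_injective.comp (π.injective.comp Sum.inr_injective)
  have hmem : minorOf k (fun q => hU.cols (π (Sum.inr q))) ∈
      MinimalGradedFreeResolution.degreePart (facetIdeal k n Δ) n := by
    refine ⟨minorOf_mem_facetIdeal hpure ht (hU.face _ ?_ ?_), isHomogeneous_minorOf _⟩
    · intro a ha
      obtain ⟨q, -, rfl⟩ := Finset.mem_image.1 ha
      exact hU.cols_mem _
    · rw [Finset.card_image_of_injective _ ht]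
      simp
  rcases Int.units_eq_one_or (Equiv.Perm.sign π) with h | h
  · rw [h] at hminor
    simp only [Units.val_one, Int.cast_one, one_mul] at hminor
    rwa [hminor]
  · rw [h] at hminor
    simp only [Units.val_neg, Units.val_one, Int.cast_neg, Int.cast_one, neg_mul, one_mul]
      at hminor
    rw [← neg_neg (enMatrix k hU.cols v).det, hminor]
    exact Submodule.neg_mem _ hmem

theorem IsBlockSet.cycle_mem {U : Finset (Fin n ×ₗ Fin m)} (hU : IsBlockSet Δ i U)
    (hpure : IsPureCard n Δ) :
    hU.cycle k ∈ koszulCycles (MinimalGradedFreeResolution.degreePart (facetIdeal k n Δ) n) i :=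
  ⟨hU.cycle_apply_mem hpure, fun _ _ _ hab hv => enCycle_eq_zero_of_eq hab hv,
    fun v _ _ hab => enCycle_comp_swap v hab, fun v j => sum_X_mul_enCycle _ _ v j⟩

theorem IsBlockSet.coeff_cycle_self {U : Finset (Fin n ×ₗ Fin m)} (hU : IsBlockSet Δ i U) :
    coeff (tupleExp (diag hU.transversal)) (hU.cycle k hU.tuple) = 1 := by
  rw [IsBlockSet.cycle, enCycle, if_pos rfl]
  have hminor := det_enMatrix_of_perm (k := k) (v := hU.tuple) hU.cols_injective 1 fun j => rfl
  simp only [Equiv.Perm.sign_one, Units.val_one, Int.cast_one, one_mul] at hminor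
  rw [hminor]
  exact coeff_minorOf_diag (hU.cols_injective.comp Sum.inr_injective)

/-- Fixing `rowCount` fixes the row sums, and each Leibniz term uses every column once. So every
multidegree of the cycle has the row and column sums of `U`. -/
theorem IsBlockSet.lex_le_of_coeff_cycle {U : Finset (Fin n ×ₗ Fin m)}
    (hU : IsBlockSet Δ i U) {v : Fin i → Fin n ×ₗ Fin m} {μ : (Fin n ×ₗ Fin m) →₀ ℕ}
    (h : coeff μ (hU.cycle k v) ≠ 0) :
    MonomialOrder.lex.toSyn (tupleExp v + μ) ≤ MonomialOrder.lex.toSyn (setExp U) := by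
  rw [IsBlockSet.cycle, enCycle] at h
  split_ifs at h with hrow
  swap
  · exact absurd (coeff_zero _) h
  obtain ⟨π, hπ, rfl⟩ := exists_perm_of_coeff_det_enMatrix h
  refine lex_le_setExp (fun ha hb hrq => hU.lt_of_lt ha hb hrq) (fun r => ?_) (fun a => ?_)
  · simp only [← hU.tupleExp_add, Finsupp.add_apply, Finset.sum_add_distrib, sum_tupleExp_row]
    exact congrArg₂ _ (congrFun hrow r) rfl
  · simp only [← hU.tupleExp_add, Finsupp.add_apply, Finset.sum_add_distrib,
      sum_tupleExp_column, ← hπ]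
    have h1 := Equiv.sum_comp π fun x => if hU.cols x = a then 1 else 0
    rw [Fintype.sum_sum_type, Fintype.sum_sum_type] at h1
    exact h1

/-- The component of multidegree `u` of a cycle. -/
noncomputable def component (u : (Fin n ×ₗ Fin m) →₀ ℕ)
    (c : (Fin i → Fin n ×ₗ Fin m) → PolyRing k n m) (v : Fin i → Fin n ×ₗ Fin m) :
    PolyRing k n m :=
  open Classical in
  if tupleExp v ≤ u then monomial (u - tupleExp v) (coeff (u - tupleExp v) (c v)) else 0

theorem coeff_component (u : (Fin n ×ₗ Fin m) →₀ ℕ)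
    (c : (Fin i → Fin n ×ₗ Fin m) → PolyRing k n m) (v : Fin i → Fin n ×ₗ Fin m)
    (μ : (Fin n ×ₗ Fin m) →₀ ℕ) :
    coeff μ (component u c v) = if tupleExp v + μ = u then coeff μ (c v) else 0 := by
  rw [component]
  by_cases hle : tupleExp v ≤ u
  · rw [if_pos hle, coeff_monomial]
    by_cases h : tupleExp v + μ = u
    · have : u - tupleExp v = μ := by rw [← h, add_tsub_cancel_left]
      rw [if_pos this, if_pos h, this]
    · rw [if_neg h, if_neg]
      rintro rfl
      exact h (add_tsub_cancel_of_le hle)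
  · rw [if_neg hle, if_neg, coeff_zero]
    rintro rfl
    exact hle le_self_add

theorem tupleExp_comp_perm {ι : Type*} (v : Fin i → ι) (π : Equiv.Perm (Fin i)) :
    tupleExp (v ∘ π) = tupleExp v :=
  Equiv.sum_comp π fun j => Finsupp.single (v j) 1

/-- The Koszul differential respects the fine multigrading, so each component of a cycle is a cycle.
-/
theorem component_mem {P P' : Submodule k (PolyRing k n m)} {u : (Fin n ×ₗ Fin m) →₀ ℕ}
    {c : (Fin i → Fin n ×ₗ Fin m) → PolyRing k n m} (hc : c ∈ koszulCycles P i)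
    (hP' : ∀ v, component u c v ∈ P') : component u c ∈ koszulCycles P' i := by
  refine ⟨hP', fun v a b hab hv => ?_, fun v a b hab => ?_, fun v j => ?_⟩
  · ext μ
    rw [coeff_component, hc.2.1 v a b hab hv, coeff_zero, ite_self]
  · ext μ
    rw [coeff_neg, coeff_component, coeff_component, tupleExp_comp_perm,
      hc.2.2.1 v a b hab, coeff_neg]
    split_ifs <;> simp
  · ext μ
    have hker := congrArg (coeff μ) (hc.2.2.2 v j)
    rw [coeff_sum] at hker ⊢
    rw [coeff_zero] at hker ⊢
    have hterm : ∀ w, coeff μ (X w * component u c (Function.update v j w)) =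
        if tupleExp v + μ = u + Finsupp.single (v j) 1 then
          coeff μ (X w * c (Function.update v j w)) else 0 := by
      intro w
      rw [coeff_X_mul', coeff_X_mul']
      by_cases hw : w ∈ μ.support
      swap
      · rw [if_neg hw, if_neg hw, ite_self]
      rw [if_pos hw, if_pos hw, coeff_component]
      refine if_congr ?_ rfl rfl
      have hle : Finsupp.single w 1 ≤ μ := by
        rw [Finsupp.single_le_iff]
        exact Nat.one_le_iff_ne_zero.2 (Finsupp.mem_support_iff.1 hw)
      have hsum : tupleExp (Function.update v j w) + (μ - Finsupp.single w 1) +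
          Finsupp.single (v j) 1 = tupleExp v + μ := by
        rw [add_right_comm, tupleExp_update, add_assoc, add_tsub_cancel_of_le hle]
      rw [← hsum]
      exact (add_left_inj _).symm
    simp only [hterm]
    split_ifs
    · exact hker
    · simp

/-- Since `U` is the largest multidegree, a nonzero value of this component is the leading term of
the corresponding value of the cycle. -/
theorem IsBlockSet.component_cycle_apply_mem {U : Finset (Fin n ×ₗ Fin m)}
    (hU : IsBlockSet Δ i U) (hpure : IsPureCard n Δ) (v : Fin i → Fin n ×ₗ Fin m) :
    component (setExp U) (hU.cycle k) v ∈
      MinimalGradedFreeResolution.degreePart (initialIdeal (facetIdeal k n Δ)) n := by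
  by_cases h0 : component (setExp U) (hU.cycle k) v = 0
  · rw [h0]
    exact Submodule.zero_mem _
  obtain ⟨μ, hμ⟩ := MvPolynomial.ne_zero_iff.1 h0
  have hmem := hU.cycle_apply_mem (k := k) hpure v
  rw [coeff_component] at hμ
  split_ifs at hμ with hsum
  swap
  · exact absurd rfl hμ
  have hne : hU.cycle k v ≠ 0 := fun h => hμ (by rw [h, coeff_zero])
  have hdeg : MonomialOrder.lex.degree (hU.cycle k v) = μ := by
    refine MonomialOrder.lex.toSyn.injective (le_antisymm ?_
      (MonomialOrder.lex.le_degree (mem_support_iff.2 hμ)))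
    have := hU.lex_le_of_coeff_cycle (MonomialOrder.lex.coeff_degree_ne_zero_iff.2 hne)
    rwa [← hsum, map_add, map_add, add_le_add_iff_left] at this
  have heq : component (setExp U) (hU.cycle k) v =
      MonomialOrder.lex.leadingTerm (hU.cycle k v) := by
    ext e
    rw [coeff_component, MonomialOrder.leadingTerm, coeff_monomial, hdeg,
      MonomialOrder.leadingCoeff, hdeg, ← hsum]
    by_cases he : e = μ
    · subst he
      simp
    · rw [if_neg (fun h => he (add_left_cancel h)), if_neg (Ne.symm he)]
  refine ⟨?_, ?_⟩
  · rw [heq]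
    exact Ideal.subset_span ⟨_, hmem.1, rfl⟩
  · rw [heq, MonomialOrder.leadingTerm, hdeg]
    have hh : (hU.cycle k v).IsHomogeneous n := hmem.2
    refine isHomogeneous_monomial _ ?_
    by_contra hd
    exact hμ (hh.coeff_eq_zero hd)

/-- Cycles with prescribed largest multidegrees are linearly independent. -/
theorem linearIndependent_of_triangular {P : Submodule k (PolyRing k n m)}
    (z : {U : Finset (Fin n ×ₗ Fin m) // IsBlockSet Δ i U} → koszulCycles P i)
    (hself : ∀ U, coeff (tupleExp (diag U.2.transversal)) ((z U).1 U.2.tuple) = 1)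
    (hle : ∀ U v μ, coeff μ ((z U).1 v) ≠ 0 →
      MonomialOrder.lex.toSyn (tupleExp v + μ) ≤ MonomialOrder.lex.toSyn (setExp U.1)) :
    LinearIndependent k z := by
  classical
  rw [Fintype.linearIndependent_iff]
  intro g hg
  by_contra! hne
  obtain ⟨U₀, hU₀⟩ := hne
  obtain ⟨U, hU, hmax⟩ := Finset.exists_max_image (Finset.univ.filter fun U => g U ≠ 0)
    (fun U => MonomialOrder.lex.toSyn (setExp U.1))
    ⟨U₀, Finset.mem_filter.2 ⟨Finset.mem_univ _, hU₀⟩⟩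
  have hgU : g U ≠ 0 := (Finset.mem_filter.1 hU).2
  have h := congrFun (congrArg (blockCoeff i Δ P) hg) U
  rw [map_sum, Finset.sum_apply, map_zero, Pi.zero_apply, Finset.sum_eq_single U] at h
  · rw [map_smul, Pi.smul_apply, smul_eq_mul] at h
    refine hgU ?_
    rw [← h]
    exact ((congrArg _ (hself U)).trans (mul_one _)).symm
  -- A contribution of `V` at the place of `U` makes `V` at least as large as `U`; maximality of `U`
  -- excludes this.
  · intro V _ hVU
    by_contra hne
    rw [map_smul, Pi.smul_apply, smul_eq_mul] at hne
    have h1 := hle V U.2.tuple _ (right_ne_zero_of_mul hne)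
    rw [U.2.tupleExp_add] at h1
    have h2 := hmax V (Finset.mem_filter.2 ⟨Finset.mem_univ _, left_ne_zero_of_mul hne⟩)
    exact hVU (Subtype.ext (setExp_injective
      (MonomialOrder.lex.toSyn.injective (le_antisymm h2 h1))))
  · simp

open Classical in
/-- The number of block sets is the dimension of the space of Koszul cycles. -/
theorem finrank_koszulCycles_eq (hn : 1 ≤ n)
    (hnonface : ∀ σ : Finset (Fin m), σ.card = n + 1 → ¬ IsINonface (cliqueComplex n Δ) 1 σ)
    {P : Submodule k (PolyRing k n m)}
    (hP : ∀ p ∈ P, p ≠ 0 → ∃ s : Fin n → Fin m, IsFaceTuple Δ s ∧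
      MonomialOrder.lex.degree p = tupleExp (diag s))
    (z : {U : Finset (Fin n ×ₗ Fin m) // IsBlockSet Δ i U} → koszulCycles P i)
    (hself : ∀ U, coeff (tupleExp (diag U.2.transversal)) ((z U).1 U.2.tuple) = 1)
    (hle : ∀ U v μ, coeff μ ((z U).1 v) ≠ 0 →
      MonomialOrder.lex.toSyn (tupleExp v + μ) ≤ MonomialOrder.lex.toSyn (setExp U.1)) :
    Module.finrank k (koszulCycles P i) =
      Fintype.card {U : Finset (Fin n ×ₗ Fin m) // IsBlockSet Δ i U} := by
  have hinj := blockCoeff_injective (i := i) hn hnonface hP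
  have : Module.Finite k (koszulCycles P i) := Module.Finite.of_injective _ hinj
  refine le_antisymm ?_
    (linearIndependent_of_triangular z hself hle).fintype_card_le_finrank
  have := LinearMap.finrank_le_finrank_of_injective hinj
  rwa [Module.finrank_fintype_fun_eq_card] at this

end LowerBound

end DetFacet

theorem mainTheorem2 (k : Type*) [Field k] (n m : ℕ) (hn : 1 ≤ n) (hnm : n ≤ m)
    (Δ : PreAbstractSimplicialComplex (Fin m)) (hpure : DetFacet.IsPureCard n Δ)
    (hnonface : ∀ σ : Finset (Fin m), σ.card = n + 1 →
      ¬ DetFacet.IsINonface (DetFacet.cliqueComplex n Δ) 1 σ)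
    (F : DetFacet.MinimalGradedFreeResolution (DetFacet.facetIdeal k n Δ))
    (G : DetFacet.MinimalGradedFreeResolution
      (DetFacet.initialIdeal (DetFacet.facetIdeal k n Δ)))
    (i : ℕ) (hi : 1 ≤ i) :
    F.betti i (n + i) = G.betti i (n + i) := by
  classical
  rw [F.betti_eq_finrank_koszulCycles fun p hp => (DetFacet.facetIdeal_low_degree hp).1,
    G.betti_eq_finrank_koszulCycles fun p hp => (DetFacet.initialIdeal_low_degree hp).1,
    DetFacet.finrank_koszulCycles_eq hn hnonface
      (fun p hp hne => DetFacet.degree_of_mem_facetIdeal hp hne)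
      (fun U => ⟨U.2.cycle k, U.2.cycle_mem hpure⟩)
      (fun U => U.2.coeff_cycle_self) (fun U _ _ h => U.2.lex_le_of_coeff_cycle h),
    DetFacet.finrank_koszulCycles_eq hn hnonface
      (fun p hp hne => DetFacet.degree_of_mem_initialIdeal hp hne)
      (fun U => ⟨DetFacet.component (DetFacet.setExp U.1) (U.2.cycle k),
        DetFacet.component_mem (U.2.cycle_mem hpure) (U.2.component_cycle_apply_mem hpure)⟩)
      (fun U => ?_) (fun U v μ h => ?_)]
  · rw [DetFacet.coeff_component, if_pos U.2.tupleExp_add, U.2.coeff_cycle_self]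
  · simp only [DetFacet.coeff_component] at h
    split_ifs at h with hsum
    · rw [hsum]
    · exact absurd rfl h
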